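/- A non-deterministic Mealy machine $M=(S,s_0,\Gamma,\Sigma,T)$ consists of a finite set of states $S$, a start state $s_0\in S$, finite input and output alphabets $\Gamma$ and $\Sigma$, each of which may contain the empty letter $\epsilon$, and a transition function $T:S\times\Gamma\to\mathcal P(S\times\Sigma)$. A computation of $M$ on an input word $x$ is a finite sequence of transitions starting in $s_0$ whose read letters, with the occurrences of $\epsilon$ deleted, form $x$; its output is the word of the written letters, with the occurrences of $\epsilon$ deleted. A census requirement is a function $c:\Sigma\setminus\{\epsilon\}\to\mathbb N$, and a word $y$ meets $c$ if every $b\in\Sigma\setminus\{\epsilon\}$ occurs exactly $c(b)$ times in $y$. The problem var-GWMM is: given a non-deterministic Mealy machine $M$, a word $x\in(\Gamma\setminus\{\epsilon\})^*$ and a census requirement $c$, is there a computation of $M$ on input $x$ whose output meets $c$? The parameter is $k=|S|+|\Gamma|+|\Sigma|$. Instances are described by strings over a finite alphabet in which the numbers $c(b)$ are encoded in unary (and states, letters and all other numbers in binary, the transitions being listed without repetition); $n$ denotes the length of the description. A parameterized problem is in XP if there are computable functions $f,g:\mathbb N\to\mathbb N$ and an algorithm that solves every instance of size $n$ and parameter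 $k$ in time at most $f(k)\,n^{g(k)}$. Algorithms are programs of a random access machine with addition and truncated subtraction at unit cost. **Theorem.** The problem var-GWMM with $c$ encoded in unary is in XP. Moreover, there are a single algorithm and an absolute constant $C$ such that the algorithm solves every instance in at most $C\cdot n^{\sigma+1}\cdot k^5$ steps, where $\sigma=|\Sigma\setminus\{\epsilon\}|$. -/

import Mathlib

/-! ## Random access machines (unit cost, additive arithmetic) -/

namespace RAM

/-- Memory of the machine: registers, and arrays of registers that are accessed by computed
indices. Register names and array names are literals of the program, so every program uses
only finitely many registers and finitely many arrays. -/
@[ext]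
structure State where
  reg : ℕ → ℕ
  arr : ℕ → ℕ → ℕ

/-- The elementary instructions. There is no multiplication, so that unit cost is the usual,
polynomially fair, cost measure. -/
inductive Instr where
  /-- `R d := c` -/
  | const (d c : ℕ)
  /-- `R d := R a` -/
  | copy (d a : ℕ)
  /-- `R d := R a + R b` -/
  | add (d a b : ℕ)
  /-- `R d := max (R a - R b) 0` -/
  | sub (d a b : ℕ)
  /-- `R d := A[R i]` for the array named `A` -/
  | load (d A i : ℕ)
  /-- `A[R i] := R a` for the array named `A` -/
  | store (A i a : ℕ)

/-- Effect of an instruction on the memory. -/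
def Instr.apply : Instr → State → State
  | .const d c, s => { s with reg := Function.update s.reg d c }
  | .copy d a, s => { s with reg := Function.update s.reg d (s.reg a) }
  | .add d a b, s => { s with reg := Function.update s.reg d (s.reg a + s.reg b) }
  | .sub d a b, s => { s with reg := Function.update s.reg d (s.reg a - s.reg b) }
  | .load d A i, s => { s with reg := Function.update s.reg d (s.arr A (s.reg i)) }
  | .store A i a, s =>
      { s with arr := Function.update s.arr A (Function.update (s.arr A) (s.reg i) (s.reg a)) }

/-- Programs, with structured control flow instead of jumps. -/
inductive Prog where
  | instr (i : Instr)
  | seq (p q : Prog)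
  /-- if `R r ≠ 0` then `p` else `q` -/
  | ite (r : ℕ) (p q : Prog)
  /-- while `R r ≠ 0` do `p` -/
  | loop (r : ℕ) (p : Prog)

/-- `Exec p s t s'`: started in memory `s`, the program `p` halts after exactly `t` steps with
memory `s'`. Every instruction and every evaluation of a test is one step. -/
inductive Exec : Prog → State → ℕ → State → Prop where
  | instr (i : Instr) (s : State) : Exec (.instr i) s 1 (i.apply s)
  | seq {p q : Prog} {s s' s'' : State} {t u : ℕ} :
      Exec p s t s' → Exec q s' u s'' → Exec (.seq p q) s (t + u) s''
  | ite_true {r : ℕ} {p q : Prog} {s s' : State} {t : ℕ} :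
      s.reg r ≠ 0 → Exec p s t s' → Exec (.ite r p q) s (t + 1) s'
  | ite_false {r : ℕ} {p q : Prog} {s s' : State} {t : ℕ} :
      s.reg r = 0 → Exec q s t s' → Exec (.ite r p q) s (t + 1) s'
  | loop_done {r : ℕ} {p : Prog} {s : State} :
      s.reg r = 0 → Exec (.loop r p) s 1 s
  | loop_step {r : ℕ} {p : Prog} {s s' s'' : State} {t u : ℕ} :
      s.reg r ≠ 0 → Exec p s t s' → Exec (.loop r p) s' u s'' →
      Exec (.loop r p) s (t + u + 1) s''

/-- The machine is deterministic: running time and final memory are determined by the program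
and the initial memory. -/
theorem Exec.deterministic {p : Prog} {s s₁ s₂ : State} {t₁ t₂ : ℕ}
    (h₁ : Exec p s t₁ s₁) (h₂ : Exec p s t₂ s₂) : t₁ = t₂ ∧ s₁ = s₂ := by
  induction h₁ generalizing t₂ s₂ with
  | instr i s => cases h₂; exact ⟨rfl, rfl⟩
  | seq _ _ ih ih' =>
    cases h₂ with
    | seq a b =>
      obtain ⟨rfl, rfl⟩ := ih a
      obtain ⟨rfl, rfl⟩ := ih' b
      exact ⟨rfl, rfl⟩
  | ite_true h _ ih =>
    cases h₂ with
    | ite_true _ a => obtain ⟨rfl, rfl⟩ := ih a; exact ⟨rfl, rfl⟩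
    | ite_false h' _ => exact absurd h' h
  | ite_false h _ ih =>
    cases h₂ with
    | ite_true h' _ => exact absurd h h'
    | ite_false _ a => obtain ⟨rfl, rfl⟩ := ih a; exact ⟨rfl, rfl⟩
  | loop_done h =>
    cases h₂ with
    | loop_done _ => exact ⟨rfl, rfl⟩
    | loop_step h' _ _ => exact absurd h h'
  | loop_step h _ _ ih ih' =>
    cases h₂ with
    | loop_done h' => exact absurd h' h
    | loop_step _ a b =>
      obtain ⟨rfl, rfl⟩ := ih a
      obtain ⟨rfl, rfl⟩ := ih' b
      exact ⟨rfl, rfl⟩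

/-- Initial memory on input `w`, a string over the alphabet `{0, …, m-1}`: cell `i` of array `0`
holds `1 +` the `i`-th letter of `w`; everything else is `0` (so that `0` marks the end). -/
def init {m : ℕ} (w : List (Fin m)) : State where
  reg _ := 0
  arr A i := if A = 0 then (w[i]?).elim 0 (fun v => (v : ℕ) + 1) else 0

/-- On input `w` the program `p` halts within `bound` steps, and it accepts (register `0` is
nonzero at the end) if and only if `yes` holds. -/
def Prog.DecidesWithin {m : ℕ} (p : Prog) (w : List (Fin m)) (yes : Prop) (bound : ℕ) : Prop :=
  ∃ (t : ℕ) (s : State), Exec p (init w) t s ∧ t ≤ bound ∧ (s.reg 0 ≠ 0 ↔ yes)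

end RAM

/-! ## Parameterized problems and the class XP -/

/-- A parameterized decision problem: instances, given to an algorithm as strings over a finite
alphabet, with a parameter and a set of yes-instances. -/
structure ParamProblem where
  Inst : Type
  alphabetSize : ℕ
  encode : Inst → List (Fin alphabetSize)
  param : Inst → ℕ
  Yes : Inst → Prop

/-- Size of an instance: the length of its description. -/
def ParamProblem.size (Q : ParamProblem) (I : Q.Inst) : ℕ := (Q.encode I).length

/-- `Q` is in XP: some algorithm solves every instance in time `f(k) * n ^ g(k)`, where `f` and
`g` are computable. -/
def ParamProblem.InXP (Q : ParamProblem) : Prop :=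
  ∃ f g : ℕ → ℕ, Computable f ∧ Computable g ∧ ∃ p : RAM.Prog, ∀ I : Q.Inst,
    p.DecidesWithin (Q.encode I) (Q.Yes I) (f (Q.param I) * Q.size I ^ g (Q.param I))

/-! ## Mealy machines -/

/-- A non-deterministic Mealy machine with set of states `S`, whose input letters other than `ε`
are the elements of `A` and whose output letters other than `ε` are the elements of `B`. The empty
letter `ε` is `none`; the flags say whether it belongs to the input alphabet and to the output
alphabet. -/
structure MealyMachine (S A B : Type) where
  start : S
  epsIn : Bool
  epsOut : Bool
  T : S → Option A → Set (S × Option B)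
  T_in : ∀ s, (T s none).Nonempty → epsIn = true
  T_out : ∀ s a s', (s', none) ∈ T s a → epsOut = true

namespace MealyMachine

variable {S A B : Type}

/-- `M.Computation s x y s'`: some sequence of transitions of `M` leads from `s` to `s'`, reads
`x` and writes `y`. Reading or writing `ε` contributes nothing to the word read or written. -/
inductive Computation (M : MealyMachine S A B) : S → List A → List B → S → Prop where
  | nil (s : S) : Computation M s [] [] s
  | cons {s s' s'' : S} {a : Option A} {b : Option B} {x : List A} {y : List B} :
      (s', b) ∈ M.T s a → Computation M s' x y s'' →
      Computation M s (a.toList ++ x) (b.toList ++ y) s''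

/-- Some computation of `M` on input `x` generates the output `y`. -/
def Generates (M : MealyMachine S A B) (x : List A) (y : List B) : Prop :=
  ∃ s, M.Computation M.start x y s

/-- `|S| + |Γ| + |Σ|` for the input alphabet `Γ` and the output alphabet `Σ` of `M`. -/
def size [Fintype S] [Fintype A] [Fintype B] (M : MealyMachine S A B) : ℕ :=
  Fintype.card S + (Fintype.card A + M.epsIn.toNat) + (Fintype.card B + M.epsOut.toNat)

end MealyMachine

/-- The word `y` meets the census requirement `c`: every letter `b` occurs exactly `c b` times. -/
def MeetsCensus {B : Type} [DecidableEq B] (y : List B) (c : B → ℕ) : Prop :=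
  ∀ b, y.count b = c b

/-! ## The problem var-GWMM with the census requirement in unary -/

/-- An instance `(M, x, c)`. States and letters are numbered from `0`; the transitions
`(s, a, s', b)`, meaning `(s', b) ∈ T(s, a)`, are listed without repetition in any order. -/
structure GWMMInstance where
  numStates : ℕ
  /-- number of input letters other than `ε` -/
  numIn : ℕ
  /-- number of output letters other than `ε` -/
  numOut : ℕ
  epsIn : Bool
  epsOut : Bool
  start : Fin numStates
  trans : List (Fin numStates × Option (Fin numIn) × Fin numStates × Option (Fin numOut))
  trans_nodup : trans.Nodup
  trans_in : ∀ τ ∈ trans, τ.2.1 = none → epsIn = true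
  trans_out : ∀ τ ∈ trans, τ.2.2.2 = none → epsOut = true
  x : List (Fin numIn)
  c : Fin numOut → ℕ

namespace GWMMInstance

/-- The Mealy machine of an instance. -/
def machine (I : GWMMInstance) : MealyMachine (Fin I.numStates) (Fin I.numIn) (Fin I.numOut) where
  start := I.start
  epsIn := I.epsIn
  epsOut := I.epsOut
  T s a := {q | (s, a, q.1, q.2) ∈ I.trans}
  T_in _ h := h.elim fun _ hq => I.trans_in _ hq rfl
  T_out _ _ _ h := I.trans_out _ h rfl

/-- Some computation of `M` on input `x` generates an output that meets `c`. -/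
def Yes (I : GWMMInstance) : Prop :=
  ∃ y : List (Fin I.numOut), I.machine.Generates I.x y ∧ MeetsCensus y I.c

/-- Binary encoding of a number, least significant bit first; the letter `2` is a separator. -/
def encBin (n : ℕ) : List (Fin 3) := (Nat.bits n).map (fun b => if b then 1 else 0) ++ [2]

/-- Unary encoding of a number. -/
def encUnary (n : ℕ) : List (Fin 3) := List.replicate n 1 ++ [2]

/-- Encoding of a letter that may be `ε`. -/
def encLetter {m : ℕ} : Option (Fin m) → List (Fin 3)
  | none => encBin 0
  | some a => encBin ((a : ℕ) + 1)

/-- Description of an instance: the census requirement is encoded in unary, everything else in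
binary. -/
def encode (I : GWMMInstance) : List (Fin 3) :=
  encBin I.numStates ++ encBin I.numIn ++ encBin I.numOut ++
  encBin I.epsIn.toNat ++ encBin I.epsOut.toNat ++ encBin I.start ++
  encBin I.trans.length ++
  I.trans.flatMap (fun τ =>
    encBin τ.1 ++ encLetter τ.2.1 ++ encBin τ.2.2.1 ++ encLetter τ.2.2.2) ++
  encBin I.x.length ++ I.x.flatMap (fun a => encBin a) ++
  (List.ofFn I.c).flatMap encUnary

end GWMMInstance

/-- The problem var-GWMM, parameterized by `|S| + |Γ| + |Σ|`, with the census requirement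
encoded in unary. -/
def varGWMMUnary : ParamProblem where
  Inst := GWMMInstance
  alphabetSize := 3
  encode := GWMMInstance.encode
  param I := I.machine.size
  Yes := GWMMInstance.Yes

/-! The search runs over configurations: a state, the position in `x`, and for each output letter
`b` the number of `b` written so far. A count above `c b` can never be repaired, so only counts up
to `c b` matter. Hence position and counts form a vector `V` with `(|x| + 1) * ∏ (c b + 1)` possible
values. Since `c` is in unary, each of these `σ + 1` factors is at most `n`, which gives `n ^ (σ +
1)` layers of `|S|` configurations each.

Read `V` as a number in mixed radix. A transition adds to it an amount that does not depend on `V`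
(`val_move`) and is never negative. So edges lead to the same layer or to a later one, and the
layers can be treated in increasing order. Only transitions that read and write `ε` stay in a layer.
They are handled by `|S| + 1` passes over all transitions: a pass that starts from marks that are
not closed marks a new state of the layer (`closed_or_le_card`). A layer thus costs about `|S| *
|T|` steps, and `|T| ≤ k ^ 4`.

Marks are sound because configurations have distinct indices (`index_injective`) and a computation
can be extended at its end (`Reach.move`). They are complete because marks closed under transitions
follow every computation to the last layer (`marked_of_computation`).

The machine cannot multiply or divide. Configurations are therefore addressed by `|S| * val V + s`.
The strides `|S| * wt j` are built by repeated addition while the input is read, and the digits of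
`V` are kept in an array that is incremented with carry. An extra overflow digit ends the search.

Programs are verified with `Runs`, which combines a step budget with a postcondition; whatever a
program does not write is recovered from `Frame`. -/

namespace RAM

/-! ## Running times and postconditions -/

/-- Does the program contain an instruction that assigns to register `r`? -/
def Prog.writesReg : Prog → ℕ → Bool
  | .instr (.const d _), r => d == r
  | .instr (.copy d _), r => d == r
  | .instr (.add d _ _), r => d == r
  | .instr (.sub d _ _), r => d == r
  | .instr (.load d _ _), r => d == r
  | .instr (.store _ _ _), _ => false
  | .seq p q, r => p.writesReg r || q.writesReg r
  | .ite _ p q, r => p.writesReg r || q.writesReg r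
  | .loop _ p, r => p.writesReg r

/-- Does the program contain an instruction that stores into the array `A`? -/
def Prog.writesArr : Prog → ℕ → Bool
  | .instr (.store B _ _), A => B == A
  | .instr _, _ => false
  | .seq p q, A => p.writesArr A || q.writesArr A
  | .ite _ p q, A => p.writesArr A || q.writesArr A
  | .loop _ p, A => p.writesArr A

/-- The memories `s` and `s'` agree wherever `p` does not write. -/
structure Frame (p : Prog) (s s' : State) : Prop where
  reg : ∀ r, p.writesReg r = false → s'.reg r = s.reg r
  arr : ∀ A, p.writesArr A = false → s'.arr A = s.arr A

theorem Frame.refl (p : Prog) (s : State) : Frame p s s := ⟨fun _ _ => rfl, fun _ _ => rfl⟩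

theorem Frame.trans {p : Prog} {s s' s'' : State} (h : Frame p s s') (h' : Frame p s' s'') :
    Frame p s s'' :=
  ⟨fun r hr => (h'.reg r hr).trans (h.reg r hr), fun A hA => (h'.arr A hA).trans (h.arr A hA)⟩

/-- Written registers and arrays are literals of the program, so for a concrete program the side
conditions of `Frame` hold by evaluation (`rfl`). -/
theorem Exec.frame {p : Prog} {s s' : State} {t : ℕ} (h : Exec p s t s') : Frame p s s' := by
  induction h with
  | instr i s =>
    constructor
    · intro r hr
      cases i <;> simp only [Prog.writesReg, beq_eq_false_iff_ne, Instr.apply] at hr ⊢ <;>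
        exact Function.update_of_ne (Ne.symm hr) _ _
    · intro A hA
      cases i <;> simp only [Prog.writesArr, beq_eq_false_iff_ne, Instr.apply] at hA ⊢
      exact Function.update_of_ne (Ne.symm hA) _ _
  | seq _ _ ih ih' =>
    constructor
    · intro r hr
      simp only [Prog.writesReg, Bool.or_eq_false_iff] at hr
      rw [ih'.reg r hr.2, ih.reg r hr.1]
    · intro A hA
      simp only [Prog.writesArr, Bool.or_eq_false_iff] at hA
      rw [ih'.arr A hA.2, ih.arr A hA.1]
  | ite_true _ _ ih =>
    constructor
    · intro r hr
      simp only [Prog.writesReg, Bool.or_eq_false_iff] at hr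
      exact ih.reg r hr.1
    · intro A hA
      simp only [Prog.writesArr, Bool.or_eq_false_iff] at hA
      exact ih.arr A hA.1
  | ite_false _ _ ih =>
    constructor
    · intro r hr
      simp only [Prog.writesReg, Bool.or_eq_false_iff] at hr
      exact ih.reg r hr.2
    · intro A hA
      simp only [Prog.writesArr, Bool.or_eq_false_iff] at hA
      exact ih.arr A hA.2
  | loop_done _ => exact Frame.refl _ _
  | loop_step _ _ _ ih ih' => exact Frame.trans ⟨fun r hr => ih.reg r hr, fun A hA => ih.arr A hA⟩ ih'

/-- Started in `s`, the program halts within `T` steps in a memory that satisfies `Q`. -/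
def Runs (p : Prog) (s : State) (T : ℕ) (Q : State → Prop) : Prop :=
  ∃ t s', Exec p s t s' ∧ t ≤ T ∧ Q s'

/-- The frame is supplied to the new postcondition, so that `P` need only mention what the program
changes. -/
theorem Runs.mono {p : Prog} {s : State} {T T' : ℕ} {P Q : State → Prop} (h : Runs p s T P)
    (hT : T ≤ T') (hQ : ∀ s', Frame p s s' → P s' → Q s') : Runs p s T' Q := by
  obtain ⟨t, s', he, ht, hP⟩ := h
  exact ⟨t, s', he, ht.trans hT, hQ s' he.frame hP⟩

/-- The second program receives what is left of the budget, so a single bound for a whole chain of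
programs is passed down and checked link by link. -/
theorem Runs.seq {p q : Prog} {s : State} {T T₁ : ℕ} {P Q : State → Prop}
    (hp : Runs p s T₁ P) (hT : T₁ ≤ T)
    (hq : ∀ s', Frame p s s' → P s' → Runs q s' (T - T₁) Q) : Runs (.seq p q) s T Q := by
  obtain ⟨t, s', he, ht, hP⟩ := hp
  obtain ⟨u, s'', he', hu, hQ⟩ := hq s' he.frame hP
  exact ⟨t + u, s'', .seq he he', by omega, hQ⟩

theorem Runs.ite {r : ℕ} {p q : Prog} {s : State} {T : ℕ} {Q : State → Prop} (hT : 1 ≤ T)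
    (hp : s.reg r ≠ 0 → Runs p s (T - 1) Q) (hq : s.reg r = 0 → Runs q s (T - 1) Q) :
    Runs (.ite r p q) s T Q := by
  by_cases h : s.reg r = 0
  · obtain ⟨t, s', he, ht, hQ⟩ := hq h
    exact ⟨t + 1, s', .ite_false h he, by omega, hQ⟩
  · obtain ⟨t, s', he, ht, hQ⟩ := hp h
    exact ⟨t + 1, s', .ite_true h he, by omega, hQ⟩

/-- A loop that works through a list: the treatment of `a` takes at most `cost a` steps. -/
theorem Runs.loop_list {α : Type} {r : ℕ} {p : Prog} {s : State} (I : List α → State → Prop)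
    (cost : α → ℕ) (l : List α) (h : I l s)
    (step : ∀ a l s', Frame p s s' → I (a :: l) s' →
      s'.reg r ≠ 0 ∧ Runs p s' (cost a) (I l))
    (done : ∀ s', Frame p s s' → I [] s' → s'.reg r = 0) :
    Runs (.loop r p) s ((l.map fun a => cost a + 1).sum + 1) (I []) := by
  suffices H : ∀ (l : List α) (s' : State), Frame p s s' → I l s' →
      Runs (.loop r p) s' ((l.map fun a => cost a + 1).sum + 1) (I []) from H l s (.refl _ _) h
  intro l
  induction l with
  | nil => intro s' hf hI; exact ⟨1, s', .loop_done (done s' hf hI), by simp, hI⟩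
  | cons a l ih =>
    intro s' hf hI
    obtain ⟨hr, t, s₁, he, ht, hI₁⟩ := step a l s' hf hI
    obtain ⟨u, s₂, he', hu, hI₂⟩ := ih s₁ (hf.trans he.frame) hI₁
    exact ⟨t + u + 1, s₂, .loop_step hr he he', by rw [List.map_cons, List.sum_cons]; omega, hI₂⟩

/-- A loop with a known number `n` of rounds of at most `c` steps each. -/
theorem Runs.loop_count {r : ℕ} {p : Prog} {s : State} (I : ℕ → State → Prop)
    (c n : ℕ) (h : I n s)
    (step : ∀ n s', Frame p s s' → I (n + 1) s' → s'.reg r ≠ 0 ∧ Runs p s' c (I n))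
    (done : ∀ s', Frame p s s' → I 0 s' → s'.reg r = 0) :
    Runs (.loop r p) s (n * (c + 1) + 1) (I 0) := by
  have := Runs.loop_list (r := r) (p := p) (s := s) (fun l s => I l.length s) (fun _ : Unit => c)
    (List.replicate n ()) (by simpa using h) (fun _ l s' hf hI => step l.length s' hf hI)
    (fun s' hf hI => done s' hf hI)
  simpa using this

/-- A loop that consumes the encodings `f a` of the members `a` of a list. -/
theorem Runs.loop_flatMap {α β : Type} {r : ℕ} {p : Prog} {s : State}
    (I : List α → State → Prop) (f : α → List β) (K : ℕ) (l : List α) (h : I l s)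
    (hf : ∀ a, 0 < K * (f a).length)
    (step : ∀ a l s', Frame p s s' → I (a :: l) s' →
      s'.reg r ≠ 0 ∧ Runs p s' (K * (f a).length - 1) (I l))
    (done : ∀ s', Frame p s s' → I [] s' → s'.reg r = 0) :
    Runs (.loop r p) s (K * (l.flatMap f).length + 1) (I []) := by
  -- One step of each budget is kept back for the test of the loop.
  have := Runs.loop_list I (fun a => K * (f a).length - 1) l h step done
  refine this.mono (le_of_eq ?_) fun _ _ h => h
  congr 1
  rw [List.length_flatMap, ← List.sum_map_mul_left]
  congr 1
  refine List.map_congr_left fun a _ => ?_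
  have := hf a
  omega

/-- Straight-line code. -/
def block : List Instr → Prog
  | [] => .instr (.copy 19 19)
  | i :: l => .seq (.instr i) (block l)

/-- Effect of straight-line code. -/
def applyAll : List Instr → State → State
  | [], s => s
  | i :: l, s => applyAll l (i.apply s)

theorem Runs.block {l : List Instr} {s : State} {T : ℕ} {Q : State → Prop}
    (hT : l.length + 1 ≤ T) (h : Q (applyAll l s)) : Runs (block l) s T Q := by
  refine ⟨l.length + 1, applyAll l s, ?_, hT, h⟩
  clear h hT
  induction l generalizing s with
  | nil =>
    have := Exec.instr (.copy 19 19) s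
    simpa [RAM.block, applyAll, Instr.apply] using this
  | cons i l ih =>
    have := Exec.seq (.instr i s) (ih (s := i.apply s))
    rw [add_comm] at this
    exact this

theorem Runs.block_seq {l : List Instr} {q : Prog} {s : State} {T : ℕ} {Q : State → Prop}
    (P : State → Prop) (hT : l.length + 1 ≤ T) (h : P (applyAll l s))
    (hq : ∀ s', Frame (RAM.block l) s s' → P s' → Runs q s' (T - (l.length + 1)) Q) :
    Runs (.seq (RAM.block l) q) s T Q :=
  Runs.seq (Runs.block le_rfl h) hT hq

/-! ## Reading numbers from the input -/

/-- The initial contents of array `0`. -/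
def inputArr {m : ℕ} (w : List (Fin m)) : ℕ → ℕ := (init w).arr 0

theorem inputArr_of_drop {m : ℕ} {w l : List (Fin m)} {i : ℕ} {a : Fin m}
    (h : w.drop i = a :: l) : inputArr w i = a + 1 ∧ w.drop (i + 1) = l := by
  have h₁ : w[i]? = some a := by
    have := congrArg (fun l => l[0]?) h
    simpa using this
  refine ⟨by simp [inputArr, init, h₁], ?_⟩
  rw [← List.drop_drop, h]
  rfl

/-- Reads a binary number into register `2`. Register `1` is the position in the input; register
`7` holds `1` and register `20` holds `3`. -/
def readNum : Prog :=
  .seq (block [.const 2 0, .const 3 1, .load 4 0 1, .sub 5 20 4])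
  (.seq (.loop 5
    (.seq (block [.sub 6 4 7])
    (.seq (.ite 6 (block [.add 2 2 3]) (block []))
      (block [.add 3 3 3, .add 1 1 7, .load 4 0 1, .sub 5 20 4]))))
  (block [.add 1 1 7]))

/-- The part `l` of the input `w` is still to be read. -/
structure Reading (w l : List (Fin 3)) (s : State) : Prop where
  one : s.reg 7 = 1
  three : s.reg 20 = 3
  input : s.arr 0 = inputArr w
  rest : w.drop (s.reg 1) = l

open GWMMInstance in
theorem readNum_runs {w l : List (Fin 3)} {s : State} (n : ℕ)
    (h : Reading w (encBin n ++ l) s) :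
    Runs readNum s (16 * (encBin n).length) (fun s' => s'.reg 2 = n ∧ Reading w l s') := by
  have hlen : (encBin n).length = (Nat.bits n).length + 1 := by simp [encBin]
  obtain ⟨h7, h20, h0, hw⟩ := h
  rw [hlen]
  refine Runs.block_seq (fun s' => s'.reg 1 = s.reg 1 ∧ s'.reg 2 = 0 ∧ s'.reg 3 = 1 ∧
    s'.reg 5 = 3 - inputArr w (s.reg 1) ∧ s'.reg 4 = inputArr w (s.reg 1)) (by simp; omega)
    (by simp [applyAll, Instr.apply, h20, h0]) ?_
  rintro s₁ hf₁ ⟨a1, a2, a3, a5, a4⟩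
  have b7 := (hf₁.reg 7 rfl).trans h7
  have b20 := (hf₁.reg 20 rfl).trans h20
  have b0 := (hf₁.arr 0 rfl).trans h0
  -- Register `3` is the current power of two, so register `2` plus register `3` times the value of
  -- the unread bits stays equal to `n`. Cells hold a letter plus one: the bits appear as `1` and
  -- `2`, the separator as `3`, so `3` minus the cell is nonzero at a bit and zero at the separator.
  refine Runs.seq (Runs.loop_list (fun (bs : List Bool) s' =>
    w.drop (s'.reg 1) = bs.map (fun b => if b then 1 else 0) ++ [2] ++ l ∧
    s'.reg 4 = inputArr w (s'.reg 1) ∧ s'.reg 5 = 3 - s'.reg 4 ∧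
    s'.reg 2 + s'.reg 3 * Nat.ofDigits 2 (bs.map fun b => cond b 1 0) = n)
    (fun _ => 12) (Nat.bits n) ?_ ?_ ?_) ?_ ?_
  · refine ⟨by rw [a1, hw]; rfl, by rw [a4, a1], by rw [a5, a4], ?_⟩
    rw [a2, a3, ← Nat.digits_two_eq_bits, Nat.ofDigits_digits]
    simp
  · rintro b bs s' hf ⟨c1, c4, c5, c2⟩
    have d7 := (hf.reg 7 rfl).trans b7
    have d20 := (hf.reg 20 rfl).trans b20
    have d0 := (hf.arr 0 rfl).trans b0
    obtain ⟨e1, e2⟩ := inputArr_of_drop (by simpa using c1)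
    rw [e1] at c4
    refine ⟨by rw [c5, c4]; cases b <;> simp, ?_⟩
    refine Runs.block_seq (fun t => t.reg 6 = b.toNat ∧ t.reg 1 = s'.reg 1 ∧
      t.reg 2 = s'.reg 2 ∧ t.reg 3 = s'.reg 3) (by simp)
      (by simp [applyAll, Instr.apply, d7, c4]; cases b <;> simp) ?_
    rintro t hft ⟨f6, f1, f2, f3⟩
    refine Runs.seq (T₁ := 3) (P := fun u => u.reg 2 = s'.reg 2 + b.toNat * s'.reg 3 ∧
      u.reg 1 = s'.reg 1 ∧ u.reg 3 = s'.reg 3) ?_ (by simp) ?_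
    · refine Runs.ite (by simp) (fun h => Runs.block (by simp) ?_)
        (fun h => Runs.block (by simp) ?_)
      all_goals
        rw [f6] at h
        cases b <;> simp [applyAll, Instr.apply, f1, f2, f3] at h ⊢
    · rintro u hfu ⟨g2, g1, g3⟩
      have i7 := ((hfu.reg 7 rfl).trans (hft.reg 7 rfl)).trans d7
      have i20 := ((hfu.reg 20 rfl).trans (hft.reg 20 rfl)).trans d20
      have i0 := ((hfu.arr 0 rfl).trans (hft.arr 0 rfl)).trans d0
      refine Runs.block (by simp) ?_
      simp only [applyAll, Instr.apply, Function.update_apply, i7, i20, i0, g1, g2, g3]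
      refine ⟨by simpa using e2, by simp, by simp, ?_⟩
      rw [← c2]
      simp only [List.map_cons, Nat.ofDigits_cons]
      cases b <;> simp <;> ring
  · rintro s' hf ⟨c1, c4, c5, c2⟩
    obtain ⟨e1, e2⟩ := inputArr_of_drop (by simpa using c1)
    rw [c5, c4, e1]
    rfl
  · simp
    omega
  · rintro s' hf ⟨c1, c4, c5, c2⟩
    obtain ⟨e1, e2⟩ := inputArr_of_drop (by simpa using c1)
    refine Runs.block (by simp; omega) ?_
    have d7 := (hf.reg 7 rfl).trans b7
    refine ⟨by simpa [applyAll, Instr.apply, Function.update_apply] using c2, ?_, ?_, ?_, ?_⟩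
    · simpa [applyAll, Instr.apply, Function.update_apply] using d7
    · simpa [applyAll, Instr.apply, Function.update_apply] using (hf.reg 20 rfl).trans b20
    · simpa [applyAll, Instr.apply, Function.update_apply] using (hf.arr 0 rfl).trans b0
    · simpa [applyAll, Instr.apply, Function.update_apply, d7] using e2

end RAM

/-! ### Numbering of letters, digit limits and place values -/

namespace GWMMInstance

/-- Number of a letter that may be `ε`, as it is stored by the algorithm. -/
def letterCode {m : ℕ} (o : Option (Fin m)) : ℕ := o.elim 0 fun a => (a : ℕ) + 1

theorem encLetter_eq {m : ℕ} (o : Option (Fin m)) : encLetter o = encBin (letterCode o) := by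
  cases o <;> rfl

/-- Number of the letter of the input word at position `i`, or `0` past the end. -/
def inputCode (I : GWMMInstance) (i : ℕ) : ℕ := (I.x[i]?).elim 0 fun a => (a : ℕ) + 1

/-- Limits of the digits of a configuration: digit `0` is the position in the input word, digit
`b + 1` is the number of letters `b` written so far, and one more digit indicates overflow. -/
def lim (I : GWMMInstance) : ℕ → ℕ
  | 0 => I.x.length
  | j + 1 => if h : j < I.numOut then I.c ⟨j, h⟩ else if j = I.numOut then 1 else 0

/-- Place values in the mixed radix number system with the digit limits `I.lim`. -/
def wt (I : GWMMInstance) (j : ℕ) : ℕ := ∏ i ∈ Finset.range j, (I.lim i + 1)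

theorem wt_zero (I : GWMMInstance) : I.wt 0 = 1 := rfl

theorem wt_succ (I : GWMMInstance) (j : ℕ) : I.wt (j + 1) = I.wt j * (I.lim j + 1) :=
  Finset.prod_range_succ _ _

/-- The encoding of a transition. -/
def encTrans (I : GWMMInstance)
    (τ : Fin I.numStates × Option (Fin I.numIn) × Fin I.numStates × Option (Fin I.numOut)) :
    List (Fin 3) :=
  encBin τ.1 ++ encLetter τ.2.1 ++ encBin τ.2.2.1 ++ encLetter τ.2.2.2

/-- The first `n` transitions are stored in the arrays `6` to `9`. -/
def HasTrans (I : GWMMInstance) (n : ℕ) (s : RAM.State) : Prop :=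
  ∀ t τ, t < n → I.trans[t]? = some τ →
    s.arr 6 t = τ.1 ∧ s.arr 7 t = letterCode τ.2.1 ∧
    s.arr 8 t = τ.2.2.1 ∧ s.arr 9 t = letterCode τ.2.2.2

end GWMMInstance

/-! ### Loading the instance into memory -/

namespace RAM

open GWMMInstance

theorem Reading.of_frame {w l : List (Fin 3)} {p : Prog} {s s' : State} (h : Reading w l s)
    (hf : Frame p s s') (h1 : s'.reg 1 = s.reg 1) (h7 : p.writesReg 7 = false := by rfl)
    (h20 : p.writesReg 20 = false := by rfl) (h0 : p.writesArr 0 = false := by rfl) :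
    Reading w l s' :=
  ⟨(hf.reg 7 h7).trans h.one, (hf.reg 20 h20).trans h.three, (hf.arr 0 h0).trans h.input,
    by rw [h1, h.rest]⟩

theorem encBin_length_pos (n : ℕ) : 0 < (encBin n).length := by simp [encBin]

theorem lt_length_of_drop_eq_cons {α : Type} {l l' : List α} {a : α} {i : ℕ}
    (h : l.drop i = a :: l') : i < l.length ∧ l[i]? = some a ∧ l.drop (i + 1) = l' := by
  refine ⟨?_, ?_, ?_⟩
  · by_contra hi
    rw [List.drop_eq_nil_of_le (by omega)] at h
    cases h
  · have := congrArg (fun l => l[0]?) h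
    simpa using this
  · rw [← List.drop_drop, h]
    rfl

/-- Reads the list of transitions. -/
def readTrans : Prog :=
  .seq readNum
  (.seq (block [.copy 10 2, .const 11 0, .sub 14 10 11])
  (.loop 14
    (.seq readNum
    (.seq (block [.store 6 11 2])
    (.seq readNum
    (.seq (block [.store 7 11 2])
    (.seq readNum
    (.seq (block [.store 8 11 2])
    (.seq readNum
    (block [.store 9 11 2, .add 11 11 7, .sub 14 10 11]))))))))))

/-- Reading costs at most `16` steps per letter. Every number has at least its separator, so the
remaining `14` per letter pay for storing and for the loop. -/
theorem readTrans_runs (I : GWMMInstance) {w l : List (Fin 3)} {s : State}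
    (h : Reading w (encBin I.trans.length ++ (I.trans.flatMap I.encTrans ++ l)) s) :
    Runs readTrans s
      (30 * (encBin I.trans.length ++ I.trans.flatMap I.encTrans).length)
      (fun s' => Reading w l s' ∧ s'.reg 10 = I.trans.length ∧ I.HasTrans I.trans.length s') := by
  have hp := encBin_length_pos I.trans.length
  rw [List.length_append]
  refine Runs.seq (readNum_runs _ h) (by omega) ?_
  rintro s₁ hf₁ ⟨h2, hR⟩
  refine Runs.block_seq (fun t => t.reg 1 = s₁.reg 1 ∧ t.reg 10 = I.trans.length ∧ t.reg 11 = 0 ∧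
    t.reg 14 = I.trans.length) (by simp; omega)
    (by simp [applyAll, Instr.apply, h2]) ?_
  rintro s₂ hf₂ ⟨a1, a10, a11, a14⟩
  have hR₂ := hR.of_frame hf₂ a1
  refine (Runs.loop_flatMap (fun l' t => Reading w (l'.flatMap I.encTrans ++ l) t ∧
    I.trans.drop (t.reg 11) = l' ∧ t.reg 14 = I.trans.length - t.reg 11 ∧ I.HasTrans (t.reg 11) t)
    I.encTrans 30 I.trans ?_ ?_ ?_ ?_).mono ?_ ?_
  · exact ⟨hR₂, by simp [a11], by rw [a11, a14]; rfl, by intro t τ ht; omega⟩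
  · intro τ
    have := encBin_length_pos τ.1
    simp only [encTrans, List.length_append]
    omega
  · rintro τ l' t hft ⟨b, b11, b14, bT⟩
    obtain ⟨hlt, hget, hdrop⟩ := lt_length_of_drop_eq_cons b11
    refine ⟨by omega, ?_⟩
    have p1 := encBin_length_pos τ.1
    have p2 := encBin_length_pos (letterCode τ.2.1)
    have p3 := encBin_length_pos τ.2.2.1
    have p4 := encBin_length_pos (letterCode τ.2.2.2)
    simp only [List.flatMap_cons, encTrans, List.append_assoc, encLetter_eq] at b
    simp only [encTrans, List.length_append, encLetter_eq]
    refine Runs.seq (readNum_runs _ b) (by omega) ?_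
    rintro t₁ hf₁ ⟨c2, c⟩
    refine Runs.block_seq (fun u => u.reg 1 = t₁.reg 1 ∧
      u.arr 6 = Function.update (t₁.arr 6) (t₁.reg 11) (t₁.reg 2)) (by simp; omega)
      (by simp [applyAll, Instr.apply]) ?_
    rintro t₂ hf₂ ⟨d1, d6⟩
    refine Runs.seq (readNum_runs _ (c.of_frame hf₂ d1)) (by simp; omega) ?_
    rintro t₃ hf₃ ⟨e2, e⟩
    refine Runs.block_seq (fun u => u.reg 1 = t₃.reg 1 ∧
      u.arr 7 = Function.update (t₃.arr 7) (t₃.reg 11) (t₃.reg 2)) (by simp; omega)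
      (by simp [applyAll, Instr.apply]) ?_
    rintro t₄ hf₄ ⟨f1, f7⟩
    refine Runs.seq (readNum_runs _ (e.of_frame hf₄ f1)) (by simp; omega) ?_
    rintro t₅ hf₅ ⟨g2, g⟩
    refine Runs.block_seq (fun u => u.reg 1 = t₅.reg 1 ∧
      u.arr 8 = Function.update (t₅.arr 8) (t₅.reg 11) (t₅.reg 2)) (by simp; omega)
      (by simp [applyAll, Instr.apply]) ?_
    rintro t₆ hf₆ ⟨i1, i8⟩
    refine Runs.seq (readNum_runs _ (g.of_frame hf₆ i1)) (by simp; omega) ?_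
    rintro t₇ hf₇ ⟨j2, j⟩
    refine Runs.mono (P := fun u => u.reg 1 = t₇.reg 1 ∧ u.reg 11 = t₇.reg 11 + t₇.reg 7 ∧
      u.reg 14 = t₇.reg 10 - (t₇.reg 11 + t₇.reg 7) ∧
      u.arr 9 = Function.update (t₇.arr 9) (t₇.reg 11) (t₇.reg 2))
      (Runs.block le_rfl (by simp [applyAll, Instr.apply])) (by simp; omega) ?_
    rintro t₈ hf₈ ⟨k1, k11, k14, k9⟩
    have r₁ := hf₁.reg 11 rfl
    have r₃ := (hf₃.reg 11 rfl).trans ((hf₂.reg 11 rfl).trans r₁)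
    have r₅ := (hf₅.reg 11 rfl).trans ((hf₄.reg 11 rfl).trans r₃)
    have r₇ := (hf₇.reg 11 rfl).trans ((hf₆.reg 11 rfl).trans r₅)
    have r10 : t₇.reg 10 = I.trans.length :=
      (hf₇.reg 10 rfl).trans <| (hf₆.reg 10 rfl).trans <| (hf₅.reg 10 rfl).trans <|
      (hf₄.reg 10 rfl).trans <| (hf₃.reg 10 rfl).trans <| (hf₂.reg 10 rfl).trans <|
      (hf₁.reg 10 rfl).trans <| (hft.reg 10 rfl).trans a10
    have m6 : t₈.arr 6 = Function.update (t.arr 6) (t.reg 11) τ.1 := by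
      rw [hf₈.arr 6 rfl, hf₇.arr 6 rfl, hf₆.arr 6 rfl, hf₅.arr 6 rfl, hf₄.arr 6 rfl,
        hf₃.arr 6 rfl, d6, hf₁.arr 6 rfl, r₁, c2]
    have m7 : t₈.arr 7 = Function.update (t.arr 7) (t.reg 11) (letterCode τ.2.1) := by
      rw [hf₈.arr 7 rfl, hf₇.arr 7 rfl, hf₆.arr 7 rfl, hf₅.arr 7 rfl, f7,
        hf₃.arr 7 rfl, hf₂.arr 7 rfl, hf₁.arr 7 rfl, r₃, e2]
    have m8 : t₈.arr 8 = Function.update (t.arr 8) (t.reg 11) τ.2.2.1 := by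
      rw [hf₈.arr 8 rfl, hf₇.arr 8 rfl, i8, hf₅.arr 8 rfl, hf₄.arr 8 rfl,
        hf₃.arr 8 rfl, hf₂.arr 8 rfl, hf₁.arr 8 rfl, r₅, g2]
    have m9 : t₈.arr 9 = Function.update (t.arr 9) (t.reg 11) (letterCode τ.2.2.2) := by
      rw [k9, hf₇.arr 9 rfl, hf₆.arr 9 rfl, hf₅.arr 9 rfl, hf₄.arr 9 rfl,
        hf₃.arr 9 rfl, hf₂.arr 9 rfl, hf₁.arr 9 rfl, r₇, j2]
    have m11 : t₈.reg 11 = t.reg 11 + 1 := by rw [k11, r₇, j.one]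
    refine ⟨j.of_frame hf₈ k1, by rw [m11, hdrop], by rw [k14, m11, r₇, r10, j.one], ?_⟩
    intro i τ' hi hτ'
    rw [m11] at hi
    rw [m6, m7, m8, m9]
    simp only [Function.update_apply]
    split_ifs with hi'
    · rw [hi', hget] at hτ'
      cases hτ'
      simp
    · exact bT i τ' (by omega) hτ'
  · rintro t hft ⟨b, b11, b14, bT⟩
    have := List.drop_eq_nil_iff.1 b11
    omega
  · simp
    omega
  · rintro t hft ⟨b, b11, b14, bT⟩
    have := List.drop_eq_nil_iff.1 b11
    exact ⟨b, (hft.reg 10 rfl).trans a10, fun i τ hi hτ => bT i τ (by omega) hτ⟩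

/-- Reads the input word, and computes the stride of the first output letter in register `17`. -/
def readWord : Prog :=
  .seq readNum
  (.seq (block [.const 12 0, .store 2 12 2, .store 3 12 8, .copy 16 2, .copy 17 8, .const 11 0,
    .sub 14 16 11])
  (.loop 14
    (.seq readNum
    (block [.add 2 2 7, .store 1 11 2, .add 17 17 8, .add 11 11 7, .sub 14 16 11]))))

/-- Register `17` starts at `|S|` and gains `|S|` with every letter of the word. This yields `|S| *
(|x| + 1)`, the stride of digit `1`, without a multiplication. -/
theorem readWord_runs (I : GWMMInstance) {w l : List (Fin 3)} {s : State}
    (h : Reading w (encBin I.x.length ++ ((I.x.map Fin.val).flatMap encBin ++ l)) s)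
    (h1 : s.arr 1 = 0) (h8 : s.reg 8 = I.numStates) :
    Runs readWord s
      (30 * (encBin I.x.length ++ (I.x.map Fin.val).flatMap encBin).length)
      (fun s' => Reading w l s' ∧ s'.reg 17 = I.numStates * I.wt 1 ∧ s'.arr 1 = I.inputCode ∧
        s'.arr 2 0 = I.lim 0 ∧ s'.arr 3 0 = I.numStates * I.wt 0) := by
  have hp := encBin_length_pos I.x.length
  rw [List.length_append]
  refine Runs.seq (readNum_runs _ h) (by omega) ?_
  rintro s₁ hf₁ ⟨h2, hR⟩
  refine Runs.block_seq (fun t => t.reg 1 = s₁.reg 1 ∧ t.reg 16 = I.x.length ∧ t.reg 11 = 0 ∧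
    t.reg 17 = I.numStates ∧ t.reg 14 = I.x.length ∧ t.arr 2 0 = I.x.length ∧
    t.arr 3 0 = I.numStates) (by simp; omega)
    (by simp [applyAll, Instr.apply, h2, hf₁.reg 8 rfl, h8]) ?_
  rintro s₂ hf₂ ⟨a1, a16, a11, a17, a14, aL, aW⟩
  have hR₂ := hR.of_frame hf₂ a1
  refine (Runs.loop_flatMap (fun l' t => Reading w (l'.flatMap encBin ++ l) t ∧
    (I.x.map Fin.val).drop (t.reg 11) = l' ∧ t.reg 14 = I.x.length - t.reg 11 ∧
    t.reg 17 = I.numStates * (t.reg 11 + 1) ∧ t.reg 11 ≤ I.x.length ∧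
    ∀ i, t.arr 1 i = if i < t.reg 11 then I.inputCode i else 0)
    encBin 30 (I.x.map Fin.val) ?_ ?_ ?_ ?_).mono ?_ ?_
  · refine ⟨hR₂, by simp [a11], by rw [a11, a14]; rfl, by rw [a17, a11]; simp, by omega, fun i => ?_⟩
    rw [hf₂.arr 1 rfl, hf₁.arr 1 rfl, h1, a11]
    simp
  · intro a
    have := encBin_length_pos a
    omega
  · rintro a l' t hft ⟨b, b11, b14, b17, ble, bX⟩
    obtain ⟨hlt, hget, hdrop⟩ := lt_length_of_drop_eq_cons b11
    rw [List.length_map] at hlt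
    refine ⟨by omega, ?_⟩
    have p1 := encBin_length_pos a
    simp only [List.flatMap_cons, List.append_assoc] at b
    refine Runs.seq (readNum_runs _ b) (by omega) ?_
    rintro t₁ hf₁' ⟨c2, c⟩
    refine Runs.mono (P := fun u => u.reg 1 = t₁.reg 1 ∧ u.reg 11 = t₁.reg 11 + t₁.reg 7 ∧
      u.reg 14 = t₁.reg 16 - (t₁.reg 11 + t₁.reg 7) ∧ u.reg 17 = t₁.reg 17 + t₁.reg 8 ∧
      u.arr 1 = Function.update (t₁.arr 1) (t₁.reg 11) (t₁.reg 2 + t₁.reg 7))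
      (Runs.block le_rfl (by simp [applyAll, Instr.apply])) (by simp; omega) ?_
    rintro t₂ hf₂' ⟨d1, d11, d14, d17, dX⟩
    have r8 : t₁.reg 8 = I.numStates := by
      rw [hf₁'.reg 8 rfl, hft.reg 8 rfl, hf₂.reg 8 rfl, hf₁.reg 8 rfl, h8]
    have r16 : t₁.reg 16 = I.x.length := by rw [hf₁'.reg 16 rfl, hft.reg 16 rfl, a16]
    have m11 : t₂.reg 11 = t.reg 11 + 1 := by rw [d11, hf₁'.reg 11 rfl, c.one]
    refine ⟨c.of_frame hf₂' d1, by rw [m11, hdrop],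
      by rw [d14, m11, r16, c.one, hf₁'.reg 11 rfl],
      by rw [d17, hf₁'.reg 17 rfl, b17, r8, m11]; ring, by omega, fun i => ?_⟩
    rw [dX, m11, Function.update_apply, hf₁'.arr 1 rfl, hf₁'.reg 11 rfl, c2, c.one, bX]
    rcases lt_trichotomy i (t.reg 11) with hi | hi | hi
    · simp [hi, hi.ne, Nat.lt_succ_of_lt hi]
    · simp only [List.getElem?_map, Option.map_eq_some_iff] at hget
      obtain ⟨a', ha', rfl⟩ := hget
      simp [hi, inputCode, ha']
    · simp [hi.ne', Nat.not_lt.2 hi.le, Nat.not_lt.2 (Nat.succ_le_of_lt hi)]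
  · rintro t hft ⟨b, b11, b14, b17, ble, bX⟩
    have := List.drop_eq_nil_iff.1 b11
    rw [List.length_map] at this
    omega
  · simp
    omega
  · rintro t hft ⟨b, b11, b14, b17, ble, bX⟩
    have hle := List.drop_eq_nil_iff.1 b11
    rw [List.length_map] at hle
    refine ⟨b, ?_, ?_, ?_, ?_⟩
    · rw [b17, wt_succ, wt_zero, one_mul, lim]
      congr 2
      omega
    · funext i
      rw [bX]
      split_ifs with hi
      · rfl
      · rw [inputCode, List.getElem?_eq_none (by omega)]
        rfl
    · rw [hft.arr 2 rfl, aL]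
      rfl
    · rw [hft.arr 3 rfl, aW, wt_zero, mul_one]

/-- Reads the census requirement, and computes the strides of the output letters. -/
def readCensus : Prog :=
  .seq (block [.const 12 0, .sub 14 9 12])
  (.seq (.loop 14
    (.seq (block [.add 12 12 7, .store 3 12 17, .copy 18 17, .const 2 0, .load 4 0 1, .sub 5 20 4])
    (.seq (.loop 5
      (block [.add 17 17 18, .add 2 2 7, .add 1 1 7, .load 4 0 1, .sub 5 20 4]))
    (block [.add 1 1 7, .store 2 12 2, .sub 14 9 12]))))
  (block [.add 12 12 7, .store 2 12 7]))

/-- The digit limits and the strides of the first digits are stored in the arrays `2` and `3`. -/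
def HasStrides (I : GWMMInstance) (n : ℕ) (s : State) : Prop :=
  ∀ j ≤ n, s.arr 2 j = I.lim j ∧ s.arr 3 j = I.numStates * I.wt j

/-- Adding the old stride once for every unary `1` of `c b` multiplies it by `c b + 1`, which is the
step from one place value to the next. The number of additions is covered by the length of the
description because `c` is in unary. -/
theorem readCensus_runs (I : GWMMInstance) {w l : List (Fin 3)} {s : State}
    (h : Reading w ((List.ofFn I.c).flatMap encUnary ++ l) s)
    (h9 : s.reg 9 = I.numOut) (h17 : s.reg 17 = I.numStates * I.wt 1) (h0 : HasStrides I 0 s) :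
    Runs readCensus s (30 * ((List.ofFn I.c).flatMap encUnary).length + 10)
      (fun s' => HasStrides I I.numOut s' ∧ s'.arr 2 (I.numOut + 1) = I.lim (I.numOut + 1)) := by
  have hlen : ∀ v, (encUnary v).length = v + 1 := by simp [encUnary]
  refine Runs.block_seq (fun t => t.reg 1 = s.reg 1 ∧ t.reg 12 = 0 ∧ t.reg 14 = I.numOut)
    (by simp) (by simp [applyAll, Instr.apply, h9]) ?_
  rintro s₁ hf₁ ⟨a1, a12, a14⟩
  have hR₁ := h.of_frame hf₁ a1
  refine Runs.seq (Runs.loop_flatMap (fun l' t => Reading w (l'.flatMap encUnary ++ l) t ∧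
    (List.ofFn I.c).drop (t.reg 12) = l' ∧ t.reg 14 = I.numOut - t.reg 12 ∧
    t.reg 12 ≤ I.numOut ∧ t.reg 17 = I.numStates * I.wt (t.reg 12 + 1) ∧
    HasStrides I (t.reg 12) t) encUnary 30 (List.ofFn I.c) ?_ ?_ ?_ ?_) ?_ ?_
  · refine ⟨hR₁, by simp [a12], by rw [a12, a14]; rfl, by omega,
      by rw [hf₁.reg 17 rfl, h17, a12], ?_⟩
    intro j hj
    rw [hf₁.arr 2 rfl, hf₁.arr 3 rfl]
    exact h0 j (by omega)
  · intro v
    rw [hlen]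
    omega
  · rintro v l' t hft ⟨b, b12, b14, ble, b17, bL⟩
    obtain ⟨hlt, hget, hdrop⟩ := lt_length_of_drop_eq_cons b12
    rw [List.length_ofFn] at hlt
    have hv : I.lim (t.reg 12 + 1) = v := by
      rw [lim, dif_pos hlt]
      simpa [hlt] using hget
    refine ⟨by omega, ?_⟩
    rw [hlen]
    have e9 : t.reg 9 = I.numOut := by rw [hft.reg 9 rfl, hf₁.reg 9 rfl, h9]
    refine Runs.block_seq (fun u => u.reg 1 = t.reg 1 ∧ u.reg 12 = t.reg 12 + 1 ∧
      u.reg 2 = 0 ∧ u.reg 4 = inputArr w (t.reg 1) ∧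
      u.reg 5 = 3 - inputArr w (t.reg 1) ∧ u.reg 18 = t.reg 17 ∧
      u.arr 3 = Function.update (t.arr 3) (t.reg 12 + 1) (t.reg 17))
      (by simp; omega) (by simp [applyAll, Instr.apply, b.one, b.three, b.input]) ?_
    rintro t₁ hf₁' ⟨c1, c12, c2, c4, c5, c18, cW⟩
    refine Runs.seq (Runs.loop_count (fun n u =>
      Reading w (List.replicate n 1 ++ [2] ++ l'.flatMap encUnary ++ l) u ∧
      u.reg 5 = 3 - inputArr w (u.reg 1) ∧ u.reg 2 + n = v ∧
      u.reg 17 = t.reg 17 * (u.reg 2 + 1)) 6 v ?_ ?_ ?_) (by simp; omega) ?_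
    · refine ⟨?_, by rw [c5, c1], by omega, by rw [hf₁'.reg 17 rfl, c2]; simp⟩
      have := b.of_frame hf₁' c1
      simpa only [List.flatMap_cons, encUnary, List.append_assoc] using this
    · rintro n u hfu ⟨d, d5, d2, d17⟩
      obtain ⟨e1, e2⟩ := inputArr_of_drop (by simpa [List.replicate_succ] using d.rest)
      refine ⟨by rw [d5, e1]; simp, Runs.block (by simp) ?_⟩
      have d18 : u.reg 18 = t.reg 17 := (hfu.reg 18 rfl).trans c18
      refine ⟨⟨?_, ?_, ?_, ?_⟩, ?_, ?_, ?_⟩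
      · simpa [applyAll, Instr.apply, Function.update_apply] using d.one
      · simpa [applyAll, Instr.apply, Function.update_apply] using d.three
      · simpa [applyAll, Instr.apply, Function.update_apply] using d.input
      · simpa [applyAll, Instr.apply, Function.update_apply, d.one] using e2
      · simp [applyAll, Instr.apply, d.one, d.three, d.input]
      · simp [applyAll, Instr.apply, d.one]
        omega
      · simp [applyAll, Instr.apply, d.one, d18, d17]
        ring
    · rintro u hfu ⟨d, d5, d2, d17⟩
      obtain ⟨e1, e2⟩ := inputArr_of_drop (by simpa using d.rest)
      rw [d5, e1]
      rfl
    · rintro u hfu ⟨d, d5, d2, d17⟩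
      obtain ⟨e1, e2⟩ := inputArr_of_drop (by simpa using d.rest)
      have u12 : u.reg 12 = t.reg 12 + 1 := (hfu.reg 12 rfl).trans c12
      refine Runs.mono (P := fun z => z.reg 1 = u.reg 1 + u.reg 7 ∧
        z.reg 14 = u.reg 9 - u.reg 12 ∧ z.arr 2 = Function.update (u.arr 2) (u.reg 12) (u.reg 2))
        (Runs.block le_rfl (by simp [applyAll, Instr.apply])) (by simp; omega) ?_
      rintro z hfz ⟨f1, f14, fL⟩
      have z12 : z.reg 12 = t.reg 12 + 1 := (hfz.reg 12 rfl).trans u12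
      refine ⟨⟨(hfz.reg 7 rfl).trans d.one, (hfz.reg 20 rfl).trans d.three,
        (hfz.arr 0 rfl).trans d.input, by rw [f1, d.one, e2]⟩, by rw [z12, hdrop], ?_, by omega,
        ?_, ?_⟩
      · rw [f14, z12, u12, hfu.reg 9 rfl, hf₁'.reg 9 rfl, e9]
      · rw [hfz.reg 17 rfl, d17, b17, z12, wt_succ I (t.reg 12 + 1), hv,
          show u.reg 2 = v by omega, mul_assoc]
      · intro j hj
        rw [z12] at hj
        rw [fL, hfz.arr 3 rfl, hfu.arr 3 rfl, cW, hfu.arr 2 rfl, hf₁'.arr 2 rfl, u12, b17,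
          Function.update_apply, Function.update_apply]
        split_ifs with hj'
        · subst hj'
          exact ⟨by omega, rfl⟩
        · exact bL j (by omega)
  · rintro t hft ⟨b, b12, b14, ble, b17, bL⟩
    have := List.drop_eq_nil_iff.1 b12
    rw [List.length_ofFn] at this
    omega
  · simp
  · rintro t hft ⟨b, b12, b14, ble, b17, bL⟩
    have hle := List.drop_eq_nil_iff.1 b12
    rw [List.length_ofFn] at hle
    have h12 : t.reg 12 = I.numOut := by omega
    refine Runs.mono (P := fun z => z.arr 2 = Function.update (t.arr 2) (I.numOut + 1) 1)
        (Runs.block le_rfl (by simp [applyAll, Instr.apply, b.one, h12])) (by simp) ?_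
    intro z hfz hz
    refine ⟨fun j hj => ?_, by simp [hz, lim]⟩
    rw [hz, hfz.arr 3 rfl, Function.update_of_ne (by omega)]
    exact bL j (by omega)

/-- Reads the part of the instance before the transitions, and marks the start configuration. -/
def readHeader : Prog :=
  .seq (block [.const 7 1, .const 20 3])
  (.seq readNum
  (.seq (block [.copy 8 2])
  (.seq readNum
  (.seq readNum
  (.seq (block [.copy 9 2])
  (.seq readNum
  (.seq readNum
  (.seq readNum
  (block [.store 5 2 7])))))))))

/-- Reads the instance. -/
def readInstance : Prog := .seq readHeader (.seq readTrans (.seq readWord readCensus))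

/-- The part of the memory that is not changed after the instance has been read. -/
structure Loaded (I : GWMMInstance) (s : State) : Prop where
  one : s.reg 7 = 1
  states : s.reg 8 = I.numStates
  letters : s.reg 9 = I.numOut
  transitions : s.reg 10 = I.trans.length
  word : s.arr 1 = I.inputCode
  strides : HasStrides I I.numOut s
  overflow : s.arr 2 (I.numOut + 1) = 1
  trans : I.HasTrans I.trans.length s

theorem encode_eq (I : GWMMInstance) :
    I.encode = encBin I.numStates ++ (encBin I.numIn ++ (encBin I.numOut ++
      (encBin I.epsIn.toNat ++ (encBin I.epsOut.toNat ++ (encBin I.start ++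
      ((encBin I.trans.length ++ I.trans.flatMap I.encTrans) ++
      ((encBin I.x.length ++ (I.x.map Fin.val).flatMap encBin) ++
      ((List.ofFn I.c).flatMap encUnary)))))))) := by
  -- In `encode` the word is coerced to a list of numbers through the list monad.
  have : (do let a ← I.x; pure (a : ℕ) : List ℕ) = I.x.map Fin.val := by
    simp [List.map_eq_flatMap]
  have h : I.encTrans = fun τ =>
    encBin τ.1 ++ encLetter τ.2.1 ++ encBin τ.2.2.1 ++ encLetter τ.2.2.2 := rfl
  simp only [encode, this, h, List.append_assoc]

theorem readHeader_runs (I : GWMMInstance) {w l : List (Fin 3)} {s : State}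
    (hw : w = encBin I.numStates ++ (encBin I.numIn ++ (encBin I.numOut ++
      (encBin I.epsIn.toNat ++ (encBin I.epsOut.toNat ++ (encBin I.start ++ l))))))
    (h0 : s.arr 0 = inputArr w) (h1 : s.reg 1 = 0) :
    Runs readHeader s
      (30 * (encBin I.numStates ++ (encBin I.numIn ++ (encBin I.numOut ++
        (encBin I.epsIn.toNat ++ (encBin I.epsOut.toNat ++ encBin I.start))))).length)
      (fun s' => Reading w l s' ∧ s'.reg 8 = I.numStates ∧ s'.reg 9 = I.numOut ∧
        s'.arr 5 = Function.update (s.arr 5) (I.start : ℕ) 1) := by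
  have p1 := encBin_length_pos I.numStates
  have p2 := encBin_length_pos I.numIn
  have p3 := encBin_length_pos I.numOut
  simp only [List.length_append]
  refine Runs.block_seq (Reading w w) (by simp; omega)
    ⟨by simp [applyAll, Instr.apply], by simp [applyAll, Instr.apply], h0,
      by simp [applyAll, Instr.apply, h1]⟩ ?_
  intro s₀ hf₀ R₀
  nth_rw 2 [hw] at R₀
  refine Runs.seq (readNum_runs _ R₀) (by simp; omega) ?_
  rintro s₁ hf₁ ⟨h₁, R₁⟩
  refine Runs.block_seq (fun s => s.reg 1 = s₁.reg 1 ∧ s.reg 8 = I.numStates) (by simp; omega)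
    (by simp [applyAll, Instr.apply, h₁]) ?_
  rintro s₂ hf₂ ⟨c₂, h8⟩
  refine Runs.seq (readNum_runs _ (R₁.of_frame hf₂ c₂)) (by simp; omega) ?_
  rintro s₃ hf₃ ⟨h₃, R₃⟩
  refine Runs.seq (readNum_runs _ R₃) (by simp; omega) ?_
  rintro s₄ hf₄ ⟨h₄, R₄⟩
  refine Runs.block_seq (fun s => s.reg 1 = s₄.reg 1 ∧ s.reg 9 = I.numOut) (by simp; omega)
    (by simp [applyAll, Instr.apply, h₄]) ?_
  rintro s₅ hf₅ ⟨c₅, h9⟩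
  refine Runs.seq (readNum_runs _ (R₄.of_frame hf₅ c₅)) (by simp; omega) ?_
  rintro s₆ hf₆ ⟨h₆, R₆⟩
  refine Runs.seq (readNum_runs _ R₆) (by simp; omega) ?_
  rintro s₇ hf₇ ⟨h₇, R₇⟩
  refine Runs.seq (readNum_runs _ R₇) (by simp; omega) ?_
  rintro s₈ hf₈ ⟨h₈, R₈⟩
  refine Runs.mono (P := fun s => s.reg 1 = s₈.reg 1 ∧
    s.arr 5 = Function.update (s₈.arr 5) (I.start : ℕ) 1)
    (Runs.block le_rfl (by simp [applyAll, Instr.apply, h₈, R₈.one])) (by simp; omega) ?_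
  rintro s₉ hf₉ ⟨c₉, h5⟩
  refine ⟨R₈.of_frame hf₉ c₉, ?_, ?_, ?_⟩
  · rw [hf₉.reg 8 rfl, hf₈.reg 8 rfl, hf₇.reg 8 rfl, hf₆.reg 8 rfl, hf₅.reg 8 rfl,
      hf₄.reg 8 rfl, hf₃.reg 8 rfl, h8]
  · rw [hf₉.reg 9 rfl, hf₈.reg 9 rfl, hf₇.reg 9 rfl, hf₆.reg 9 rfl, h9]
  · rw [h5, hf₈.arr 5 rfl, hf₇.arr 5 rfl, hf₆.arr 5 rfl, hf₅.arr 5 rfl, hf₄.arr 5 rfl,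
      hf₃.arr 5 rfl, hf₂.arr 5 rfl, hf₁.arr 5 rfl, hf₀.arr 5 rfl]

theorem readInstance_runs (I : GWMMInstance) :
    Runs readInstance (init I.encode) (60 * I.encode.length)
      (fun s => Loaded I s ∧ s.reg 0 = 0 ∧ s.arr 4 = 0 ∧
        s.arr 5 = Function.update (0 : ℕ → ℕ) (I.start : ℕ) 1) := by
  have hlen := congrArg List.length (encode_eq I)
  have p1 := encBin_length_pos I.numStates
  refine Runs.seq (readHeader_runs I (encode_eq I) rfl rfl)
    (by simp only [List.length_append] at hlen ⊢; omega) ?_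
  rintro s₁ hf₁ ⟨R₁, h8, h9, h5⟩
  rw [List.append_assoc, List.append_assoc] at R₁
  refine Runs.seq (readTrans_runs I R₁)
    (by simp only [List.length_append] at hlen ⊢; omega) ?_
  rintro s₂ hf₂ ⟨R₂, h10, hT⟩
  refine Runs.seq (readWord_runs I R₂
    (by rw [hf₂.arr 1 rfl, hf₁.arr 1 rfl]; rfl) ((hf₂.reg 8 rfl).trans h8))
    (by simp only [List.length_append] at hlen ⊢; omega) ?_
  rintro s₃ hf₃ ⟨R₃, h17, hX, hL, hW⟩
  refine (readCensus_runs I (l := []) (by simpa using R₃)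
    (by rw [hf₃.reg 9 rfl, hf₂.reg 9 rfl, h9]) h17 fun j hj => ?_).mono
    (by simp only [List.length_append] at hlen ⊢; omega) ?_
  · obtain rfl : j = 0 := by omega
    exact ⟨hL, hW⟩
  rintro s hf ⟨hS, hO⟩
  refine ⟨⟨(hf.reg 7 rfl).trans R₃.one, ?_, ?_, ?_, ?_, hS, ?_, ?_⟩, ?_, ?_, ?_⟩
  · rw [hf.reg 8 rfl, hf₃.reg 8 rfl, hf₂.reg 8 rfl, h8]
  · rw [hf.reg 9 rfl, hf₃.reg 9 rfl, hf₂.reg 9 rfl, h9]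
  · rw [hf.reg 10 rfl, hf₃.reg 10 rfl, h10]
  · rw [hf.arr 1 rfl, hX]
  · rw [hO]
    simp [lim]
  · intro t τ ht hτ
    rw [hf.arr 6 rfl, hf.arr 7 rfl, hf.arr 8 rfl, hf.arr 9 rfl, hf₃.arr 6 rfl, hf₃.arr 7 rfl,
      hf₃.arr 8 rfl, hf₃.arr 9 rfl]
    exact hT t τ ht hτ
  · rw [hf.reg 0 rfl, hf₃.reg 0 rfl, hf₂.reg 0 rfl, hf₁.reg 0 rfl]
    rfl
  · rw [hf.arr 4 rfl, hf₃.arr 4 rfl, hf₂.arr 4 rfl, hf₁.arr 4 rfl]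
    rfl
  · rw [hf.arr 5 rfl, hf₃.arr 5 rfl, hf₂.arr 5 rfl, h5]
    rfl

end RAM

/-! ## Computations -/

/-- `Computation` grows at its beginning, whereas marking extends a computation at its end. -/
theorem MealyMachine.Computation.snoc {S A B : Type} {M : MealyMachine S A B} {s s' s'' : S}
    {x : List A} {y : List B} {a : Option A} {b : Option B} (h : M.Computation s x y s')
    (ht : (s'', b) ∈ M.T s' a) : M.Computation s (x ++ a.toList) (y ++ b.toList) s'' := by
  induction h with
  | nil s => simpa using Computation.cons ht (.nil s'')
  | cons h _ ih => simpa only [List.append_assoc] using Computation.cons h (ih ht)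

namespace GWMMInstance

variable (I : GWMMInstance)

/-! ## Mixed radix numbers -/

/-- Value of the number with the digits `V`. -/
def val (V : ℕ → ℕ) : ℕ := ∑ j ∈ Finset.range (I.numOut + 2), V j * I.wt j

theorem lim_eq_zero {j : ℕ} (hj : I.numOut + 1 < j) : I.lim j = 0 := by
  cases j with
  | zero => omega
  | succ j => simp [lim, show ¬ j < I.numOut by omega, show j ≠ I.numOut by omega]

theorem lim_overflow : I.lim (I.numOut + 1) = 1 := by simp [lim]

theorem wt_pos (j : ℕ) : 0 < I.wt j := Finset.prod_pos fun _ _ => Nat.succ_pos _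

/-- Telescoping: `lim j * wt j` is the difference of consecutive place values. For radix ten this is
`99 + 1 = 100`. -/
theorem sum_lim_add_one (m : ℕ) : ∑ j ∈ Finset.range m, I.lim j * I.wt j + 1 = I.wt m := by
  induction m with
  | zero => rfl
  | succ m ih => rw [Finset.sum_range_succ, wt_succ, ← ih]; ring

variable {I}

theorem sum_lt_wt {V : ℕ → ℕ} (h : V ≤ I.lim) (m : ℕ) :
    ∑ j ∈ Finset.range m, V j * I.wt j < I.wt m := by
  rw [← sum_lim_add_one, Nat.lt_succ_iff]
  exact Finset.sum_le_sum fun j _ => Nat.mul_le_mul_right _ (h j)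

/-- The lower digits sum to less than `wt m`, so the top digit is the quotient by `wt m`; cancel it
and descend. -/
theorem digits_unique {V V' : ℕ → ℕ} (h : V ≤ I.lim) (h' : V' ≤ I.lim) (m : ℕ)
    (heq : ∑ j ∈ Finset.range m, V j * I.wt j = ∑ j ∈ Finset.range m, V' j * I.wt j) :
    ∀ j < m, V j = V' j := by
  induction m with
  | zero => intro j hj; omega
  | succ m ih =>
    rw [Finset.sum_range_succ, Finset.sum_range_succ] at heq
    have hm : V m = V' m := by
      have := congrArg (· / I.wt m) heq
      simpa [Nat.add_mul_div_right _ _ (I.wt_pos m), Nat.div_eq_of_lt (sum_lt_wt h m),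
        Nat.div_eq_of_lt (sum_lt_wt h' m)] using this
    intro j hj
    rcases Nat.lt_succ_iff_lt_or_eq.1 hj with hj | rfl
    · refine ih ?_ j hj
      rw [hm] at heq
      exact Nat.add_right_cancel heq
    · exact hm

theorem val_injective {V V' : ℕ → ℕ} (h : V ≤ I.lim) (h' : V' ≤ I.lim)
    (heq : I.val V = I.val V') : V = V' := by
  funext j
  by_cases hj : j < I.numOut + 2
  · exact digits_unique h h' _ heq j hj
  · have := I.lim_eq_zero (j := j) (by omega)
    have h₁ : V j ≤ I.lim j := h j
    have h₂ : V' j ≤ I.lim j := h' j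
    omega

/-- The place value of the overflow digit exceeds everything that the lower digits contribute. The
genuine layers are thus exactly those with values below `wt (numOut + 1)`. -/
theorem val_lt_iff {V : ℕ → ℕ} (h : V ≤ I.lim) :
    I.val V < I.wt (I.numOut + 1) ↔ V (I.numOut + 1) = 0 := by
  rw [val, Finset.sum_range_succ]
  have := sum_lt_wt h (I.numOut + 1)
  constructor
  · intro hlt
    by_contra h0
    have := Nat.le_mul_of_pos_left (I.wt (I.numOut + 1)) (Nat.pos_of_ne_zero h0)
    omega
  · intro h0
    rw [h0]
    omega

/-- The digits after the number with the digits `V` is incremented, where `m` is the first digit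
that is not at its limit. -/
def incr (m : ℕ) (V : ℕ → ℕ) : ℕ → ℕ :=
  Function.update (fun j => if j < m then 0 else V j) m (V m + 1)

/-- Resetting the `m` full digits loses `wt m - 1`, and raising digit `m` gains `wt m`. -/
theorem val_incr {V : ℕ → ℕ} {m : ℕ} (hm : m ≤ I.numOut + 1) (hV : ∀ j < m, V j = I.lim j) :
    I.val (incr m V) = I.val V + 1 := by
  have key : ∀ n, m + 1 ≤ n → ∑ j ∈ Finset.range n, incr m V j * I.wt j =
      ∑ j ∈ Finset.range n, V j * I.wt j + 1 := by
    intro n hn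
    induction n, hn using Nat.le_induction with
    | base =>
      rw [Finset.sum_range_succ, Finset.sum_range_succ, Finset.sum_eq_zero,
        Finset.sum_congr rfl fun j hj => by rw [hV j (Finset.mem_range.1 hj)]]
      · have := I.sum_lim_add_one m
        simp only [incr, Function.update_self, add_mul, one_mul]
        omega
      · intro j hj
        have hj := Finset.mem_range.1 hj
        simp [incr, Function.update_of_ne hj.ne, hj]
    | succ n hn ih =>
      rw [Finset.sum_range_succ, Finset.sum_range_succ, ih, incr,
        Function.update_of_ne (by omega), if_neg (by omega)]
      ring
  exact key _ (by omega)

theorem incr_le_lim {V : ℕ → ℕ} {m : ℕ} (h : V ≤ I.lim) (hm : V m < I.lim m) :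
    incr m V ≤ I.lim := by
  intro j
  rw [incr, Function.update_apply]
  split_ifs with h₁ h₂
  · rw [h₁]; exact hm
  · exact Nat.zero_le _
  · exact h j

/-! ## The configuration graph -/

/-- Code `0` stands both for `ε` and for the end of the word; the hypothesis keeps the two apart. -/
theorem inputCode_eq_letterCode {i : ℕ} {a : Option (Fin I.numIn)} (ha : letterCode a ≠ 0) :
    I.inputCode i = letterCode a ↔ I.x[i]? = a := by
  cases a with
  | none => exact absurd rfl ha
  | some a =>
    cases h : I.x[i]? with
    | none => simp [inputCode, letterCode, h]
    | some b => simp [inputCode, letterCode, h, Fin.ext_iff]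

variable (I) in
/-- The transition may be taken at the position, and with the numbers of written letters, that
are given by the digits. -/
def Enabled (V : ℕ → ℕ)
    (τ : Fin I.numStates × Option (Fin I.numIn) × Fin I.numStates × Option (Fin I.numOut)) :
    Prop :=
  (letterCode τ.2.1 = 0 ∨ I.inputCode (V 0) = letterCode τ.2.1) ∧
  (letterCode τ.2.2.2 = 0 ∨ V (letterCode τ.2.2.2) < I.lim (letterCode τ.2.2.2))

/-- The digits after a transition. -/
def move (V : ℕ → ℕ)
    (τ : Fin I.numStates × Option (Fin I.numIn) × Fin I.numStates × Option (Fin I.numOut)) :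
    ℕ → ℕ := fun j =>
  V j + (if letterCode τ.2.1 ≠ 0 ∧ j = 0 then 1 else 0) +
    (if letterCode τ.2.2.2 ≠ 0 ∧ j = letterCode τ.2.2.2 then 1 else 0)

/-- The change of the value of the digits in a transition. -/
def shift (τ : Fin I.numStates × Option (Fin I.numIn) × Fin I.numStates × Option (Fin I.numOut)) :
    ℕ :=
  (if letterCode τ.2.1 = 0 then 0 else 1) +
    (if letterCode τ.2.2.2 = 0 then 0 else I.wt (letterCode τ.2.2.2))

theorem letterCode_le {m : ℕ} (o : Option (Fin m)) : letterCode o ≤ m := by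
  cases o with
  | none => exact Nat.zero_le _
  | some a => exact a.2

variable {V : ℕ → ℕ} {R : ℕ → ℕ}
  {τ : Fin I.numStates × Option (Fin I.numIn) × Fin I.numStates × Option (Fin I.numOut)}

/-- Reading raises digit `0`, of place value `1`, and writing raises the digit whose number is the
letter code. The change depends on `τ` alone, so the target is addressed by additions only. -/
theorem val_move : I.val (move V τ) = I.val V + I.shift τ := by
  have hb := letterCode_le τ.2.2.2
  simp only [val, move, shift, add_mul, Finset.sum_add_distrib, ite_and, ite_mul, zero_mul, one_mul]
  rw [add_assoc]
  congr 1
  congr 1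
  · by_cases h : letterCode τ.2.1 = 0 <;> simp [h, wt_zero]
  · by_cases h : letterCode τ.2.2.2 = 0
    · simp [h]
    · simp [h]
      omega

theorem move_le_lim (h : V ≤ I.lim) (he : I.Enabled V τ) : move V τ ≤ I.lim := by
  intro j
  have hj := h j
  by_cases ha : letterCode τ.2.1 ≠ 0 ∧ j = 0
  · obtain ⟨ha, rfl⟩ := ha
    have h₁ := (inputCode_eq_letterCode ha).1 (he.1.resolve_left ha)
    have h₂ : V 0 < I.x.length := by
      by_contra hlt
      rw [List.getElem?_eq_none (by omega)] at h₁
      rw [← h₁] at ha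
      exact ha rfl
    -- Codes of output letters are at least `1`, so writing never touches the position in digit `0`.
    have h₃ : ¬ (letterCode τ.2.2.2 ≠ 0 ∧ 0 = letterCode τ.2.2.2) := fun h => h.1 h.2.symm
    rw [move, if_pos ⟨ha, rfl⟩, if_neg h₃]
    exact h₂
  · rw [move, if_neg ha]
    split_ifs with hb
    · obtain ⟨hb, rfl⟩ := hb
      exact he.2.resolve_left hb
    · exact hj

theorem move_overflow : move V τ (I.numOut + 1) = V (I.numOut + 1) := by
  have hb := letterCode_le τ.2.2.2
  rw [move, if_neg (by omega), if_neg (by omega)]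
  rfl

variable (I) in
/-- Some computation that leads to the state `s` reads and writes as much as the digits say. -/
def Reach (V : ℕ → ℕ) (s : Fin I.numStates) : Prop :=
  ∃ y, I.machine.Computation I.start (I.x.take (V 0)) y s ∧
    ∀ b : Fin I.numOut, y.count b = V (b + 1)

theorem Reach.move (h : I.Reach V τ.1) (he : I.Enabled V τ) (hτ : τ ∈ I.trans) :
    I.Reach (move V τ) τ.2.2.1 := by
  obtain ⟨y, hc, hy⟩ := h
  refine ⟨y ++ τ.2.2.2.toList, ?_, fun b => ?_⟩
  · have : I.x.take (GWMMInstance.move V τ 0) = I.x.take (V 0) ++ τ.2.1.toList := by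
      have h₃ : ¬ (letterCode τ.2.2.2 ≠ 0 ∧ 0 = letterCode τ.2.2.2) := fun h => h.1 h.2.symm
      rw [GWMMInstance.move, if_neg h₃]
      by_cases ha : letterCode τ.2.1 = 0
      · have : τ.2.1 = none := by
          cases h : τ.2.1 with
          | none => rfl
          | some a => rw [h] at ha; exact absurd ha (Nat.succ_ne_zero _)
        rw [if_neg (fun h => h.1 ha), this, add_zero, add_zero, Option.toList_none, List.append_nil]
      · rw [if_pos ⟨ha, rfl⟩, add_zero, List.take_add_one,
          (inputCode_eq_letterCode ha).1 (he.1.resolve_left ha)]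
    rw [this]
    exact hc.snoc hτ
  · rw [List.count_append, hy, GWMMInstance.move, if_neg (by omega), add_zero]
    congr 1
    cases h : τ.2.2.2 with
    | none => simp [letterCode]
    | some b' =>
      by_cases hb : b = b'
      · simp [letterCode, hb]
      · have : (b : ℕ) ≠ b' := fun h => hb (Fin.ext h)
        simp [letterCode, this, Ne.symm hb]

/-! ## Marking the reachable configurations -/

open Classical in
variable (I) in
/-- Marks the target of a transition if its source is marked. -/
noncomputable def markStep (V : ℕ → ℕ) (R : ℕ → ℕ)
    (τ : Fin I.numStates × Option (Fin I.numIn) × Fin I.numStates × Option (Fin I.numOut)) :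
    ℕ → ℕ :=
  if R (I.numStates * I.val V + τ.1) ≠ 0 ∧ I.Enabled V τ then
    Function.update R (I.numStates * (I.val V + I.shift τ) + τ.2.2.1) 1
  else R

variable (I) in
/-- Marks along all transitions. -/
noncomputable def markPass (V : ℕ → ℕ) (R : ℕ → ℕ) : ℕ → ℕ := I.trans.foldl (I.markStep V) R

variable (I) in
/-- Only reachable configurations are marked. -/
def Sound (R : ℕ → ℕ) : Prop :=
  ∀ i, R i ≠ 0 → ∃ V s, V ≤ I.lim ∧ V (I.numOut + 1) = 0 ∧
    i = I.numStates * I.val V + (s : Fin I.numStates) ∧ I.Reach V s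

variable (I) in
/-- The successors of the marked configurations with the digits `V` are marked. -/
def Closed (R : ℕ → ℕ) (V : ℕ → ℕ) : Prop :=
  ∀ τ ∈ I.trans, I.Enabled V τ → R (I.numStates * I.val V + τ.1) ≠ 0 →
    R (I.numStates * (I.val V + I.shift τ) + τ.2.2.1) ≠ 0

theorem index_injective {V' : ℕ → ℕ} {s s' : Fin I.numStates} (h : V ≤ I.lim) (h' : V' ≤ I.lim)
    (heq : I.numStates * I.val V + s = I.numStates * I.val V' + s') : V = V' ∧ s = s' := by
  have hS : 0 < I.numStates := s.pos
  have h₁ := congrArg (· / I.numStates) heq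
  simp only [Nat.mul_add_div hS, Nat.div_eq_of_lt s.2, Nat.div_eq_of_lt s'.2, add_zero] at h₁
  rw [h₁] at heq
  exact ⟨val_injective h h' h₁, Fin.ext (Nat.add_left_cancel heq)⟩

theorem Sound.reach (hR : I.Sound R) (h : V ≤ I.lim) {s : Fin I.numStates}
    (hs : R (I.numStates * I.val V + s) ≠ 0) : I.Reach V s := by
  obtain ⟨V', s', h', _, heq, hr⟩ := hR _ hs
  obtain ⟨rfl, rfl⟩ := index_injective h h' heq
  exact hr

theorem Sound.markStep (hR : I.Sound R) (h : V ≤ I.lim) (h0 : V (I.numOut + 1) = 0)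
    (hτ : τ ∈ I.trans) : I.Sound (I.markStep V R τ) := by
  intro i hi
  rw [GWMMInstance.markStep] at hi
  split_ifs at hi with hm
  · rw [Function.update_apply] at hi
    split_ifs at hi with hi'
    · exact ⟨move V τ, τ.2.2.1, move_le_lim h hm.2, by rw [move_overflow, h0],
        by rw [hi', val_move], (hR.reach h hm.1).move hm.2 hτ⟩
    · exact hR i hi
  · exact hR i hi

theorem Sound.markPass (hR : I.Sound R) (h : V ≤ I.lim) (h0 : V (I.numOut + 1) = 0) :
    I.Sound (I.markPass V R) := by
  have : ∀ l ⊆ I.trans, ∀ R, I.Sound R → I.Sound (l.foldl (I.markStep V) R) := by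
    intro l
    induction l with
    | nil => exact fun _ _ hR => hR
    | cons τ l ih =>
      intro hl R hR
      exact ih (List.subset_of_cons_subset hl) _ (hR.markStep h h0 (hl List.mem_cons_self))
  exact this _ (List.Subset.refl _) R hR

theorem markStep_mono {i : ℕ} (h : R i ≠ 0) : I.markStep V R τ i ≠ 0 := by
  rw [markStep]
  split_ifs
  · rw [Function.update_apply]
    split_ifs
    · exact one_ne_zero
    · exact h
  · exact h

theorem foldl_markStep_mono
    (l : List (Fin I.numStates × Option (Fin I.numIn) × Fin I.numStates × Option (Fin I.numOut)))
    {i : ℕ} (h : R i ≠ 0) : l.foldl (I.markStep V) R i ≠ 0 := by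
  induction l generalizing R with
  | nil => exact h
  | cons τ l ih => exact ih (markStep_mono h)

theorem markPass_mono {i : ℕ} (h : R i ≠ 0) : I.markPass V R i ≠ 0 := foldl_markStep_mono _ h

theorem markPass_target (hτ : τ ∈ I.trans) (he : I.Enabled V τ)
    (h : R (I.numStates * I.val V + τ.1) ≠ 0) :
    I.markPass V R (I.numStates * (I.val V + I.shift τ) + τ.2.2.1) ≠ 0 := by
  rw [markPass]
  generalize I.trans = l at hτ
  induction l generalizing R with
  | nil => cases hτ
  | cons τ' l ih =>
    rcases List.mem_cons.1 hτ with rfl | hτ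
    · refine foldl_markStep_mono l ?_
      rw [markStep, if_pos ⟨h, he⟩, Function.update_self]
      exact one_ne_zero
    · exact ih (markStep_mono h) hτ

/-- Shifts are nonnegative, so every target lies in the current layer or beyond it. This is why a
finished layer never has to be revisited. -/
theorem markPass_of_lt {i : ℕ} (hi : i < I.numStates * I.val V) : I.markPass V R i = R i := by
  rw [markPass]
  generalize I.trans = l
  induction l generalizing R with
  | nil => rfl
  | cons τ l ih =>
    rw [List.foldl_cons, ih, markStep]
    split_ifs
    · rw [Function.update_of_ne]
      rw [mul_add]
      omega
    · rfl

theorem Closed.markPass_iff (h : I.Closed R V) (i : ℕ) : I.markPass V R i ≠ 0 ↔ R i ≠ 0 := by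
  have : ∀ l ⊆ I.trans, ∀ R', (∀ i, R' i ≠ 0 ↔ R i ≠ 0) →
      (∀ i, l.foldl (I.markStep V) R' i ≠ 0 ↔ R i ≠ 0) := by
    intro l
    induction l with
    | nil => exact fun _ _ hR => hR
    | cons τ l ih =>
      intro hl R' hR
      refine ih (List.subset_of_cons_subset hl) _ fun i => ?_
      rw [markStep]
      split_ifs with hm
      · rw [Function.update_apply]
        split_ifs with hi
        · rw [hi]
          simpa using h τ (hl List.mem_cons_self) hm.2 ((hR _).1 hm.1)
        · exact hR i
      · exact hR i
  exact this _ (List.Subset.refl _) R (fun _ => Iff.rfl) i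

/-! ### Saturation of a single layer -/

variable (I) in
/-- The marked states in the layer with the digits `V`. -/
def markedStates (V R : ℕ → ℕ) : Finset (Fin I.numStates) :=
  Finset.univ.filter fun s => R (I.numStates * I.val V + s) ≠ 0

/-- A pass either marks a new state of the layer or leaves the layer closed, and later passes keep
it closed. -/
theorem closed_or_le_card (p : ℕ) :
    I.Closed ((I.markPass V)^[p] R) V ∨ p ≤ (I.markedStates V ((I.markPass V)^[p] R)).card := by
  induction p with
  | zero => exact .inr (Nat.zero_le _)
  | succ p ih =>
    rw [Function.iterate_succ_apply']
    generalize (I.markPass V)^[p] R = R' at ih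
    rcases ih with h | h
    · left
      intro τ hτ he hs
      rw [h.markPass_iff] at hs ⊢
      exact h τ hτ he hs
    · have hsub : I.markedStates V R' ⊆ I.markedStates V (I.markPass V R') := by
        intro s hs
        rw [markedStates, Finset.mem_filter] at hs ⊢
        exact ⟨hs.1, markPass_mono hs.2⟩
      -- If no state of the layer is new, every marked source was already marked when the pass
      -- began, so the pass has marked its targets.
      by_cases heq : I.markedStates V R' = I.markedStates V (I.markPass V R')
      · left
        intro τ hτ he hs
        have : τ.1 ∈ I.markedStates V (I.markPass V R') := by simpa [markedStates] using hs
        rw [← heq, markedStates, Finset.mem_filter] at this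
        exact markPass_target hτ he this.2
      · right
        exact lt_of_le_of_lt h (Finset.card_lt_card (hsub.ssubset_of_ne heq))

variable (I) in
/-- Marks all reachable configurations in the layer with the digits `V`, and their successors. -/
noncomputable def markLayer (V R : ℕ → ℕ) : ℕ → ℕ := (I.markPass V)^[I.numStates + 1] R

theorem closed_markLayer : I.Closed (I.markLayer V R) V := by
  -- The layer has only `|S|` states and cannot contain `|S| + 1` marked ones.
  refine (closed_or_le_card (I.numStates + 1)).resolve_right fun h => ?_
  have := h.trans (Finset.card_le_univ _)
  rw [Fintype.card_fin] at this
  omega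

/-- A property of the marks that is preserved by every pass is preserved in a layer. -/
theorem markLayer_induction {P : (ℕ → ℕ) → Prop} (hP : ∀ R, P R → P (I.markPass V R)) (h : P R) :
    P (I.markLayer V R) := by
  rw [markLayer]
  generalize I.numStates + 1 = p
  induction p with
  | zero => exact h
  | succ p ih =>
    rw [Function.iterate_succ_apply']
    exact hP _ ih

/-! ### Layers in increasing order -/

variable (I) in
/-- The layers before the one with the digits `V` have been treated. -/
structure Progress (V R : ℕ → ℕ) : Prop where
  le_lim : V ≤ I.lim
  sound : I.Sound R
  start : R I.start ≠ 0
  closed : ∀ V' ≤ I.lim, I.val V' < I.val V → I.Closed R V'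

theorem val_zero : I.val 0 = 0 := by simp [val]

theorem Progress.init : I.Progress 0 (Function.update (0 : ℕ → ℕ) (I.start : ℕ) 1) := by
  refine ⟨fun j => Nat.zero_le _, fun i hi => ?_, by simp, fun V' _ h => ?_⟩
  · rw [Function.update_apply] at hi
    split_ifs at hi with h
    · refine ⟨0, I.start, fun j => Nat.zero_le _, rfl, by rw [h, val_zero, mul_zero, zero_add], ?_⟩
      exact ⟨[], by simpa using .nil _, fun b => rfl⟩
    · exact absurd rfl hi
  · rw [val_zero] at h
    omega

/-- The layers before `V'` are the earlier ones and that of `V`. The earlier ones stay closed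
because they receive no new marks and no mark is erased; that of `V` has just been saturated. -/
theorem Progress.markLayer (h : I.Progress V R) (h0 : V (I.numOut + 1) = 0) {V' : ℕ → ℕ}
    (hle : V' ≤ I.lim) (hval : I.val V' = I.val V + 1) : I.Progress V' (I.markLayer V R) := by
  refine ⟨hle, ?_, ?_, fun W hW hlt => ?_⟩
  · exact markLayer_induction (fun R hR => hR.markPass h.le_lim h0) h.sound
  · exact markLayer_induction (P := fun R => R I.start ≠ 0) (fun R => markPass_mono) h.start
  · rw [hval] at hlt
    rcases Nat.lt_succ_iff_lt_or_eq.1 hlt with hlt | heq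
    · refine markLayer_induction (P := fun R => I.Closed R W) (fun R hR τ hτ he hs => ?_)
        (h.closed W hW hlt)
      rw [markPass_of_lt] at hs
      · exact markPass_mono (hR τ hτ he hs)
      · have := Nat.mul_le_mul_left I.numStates (Nat.succ_le_of_lt hlt)
        rw [Nat.mul_succ] at this
        have := τ.1.2
        omega
    · rw [val_injective hW h.le_lim heq]
      exact closed_markLayer

/-! ### Acceptance -/

variable (I) in
/-- The digits of the accepting configurations. -/
def finalDigits (j : ℕ) : ℕ := if j ≤ I.numOut then I.lim j else 0

theorem finalDigits_le : I.finalDigits ≤ I.lim := by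
  intro j
  rw [finalDigits]
  split_ifs
  · exact le_rfl
  · exact Nat.zero_le _

theorem val_finalDigits : I.val I.finalDigits + 1 = I.wt (I.numOut + 1) := by
  rw [← sum_lim_add_one, val, Finset.sum_range_succ]
  simp only [finalDigits]
  rw [if_neg (by omega), zero_mul, add_zero]
  congr 1
  refine Finset.sum_congr rfl fun j hj => ?_
  rw [if_pos (Nat.lt_succ_iff.1 (Finset.mem_range.1 hj))]

theorem eq_finalDigits (h : V ≤ I.lim) (h0 : V (I.numOut + 1) = 0) (hx : I.x.length ≤ V 0)
    (hc : ∀ b : Fin I.numOut, V (b + 1) = I.c b) : V = I.finalDigits := by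
  funext j
  have hj := h j
  cases j with
  | zero => rw [finalDigits, if_pos (Nat.zero_le _)]; exact le_antisymm hj hx
  | succ j =>
    rw [finalDigits]
    split_ifs with hlt
    · rw [lim, dif_pos (by omega)]
      exact hc ⟨j, hlt⟩
    · by_cases hj' : j = I.numOut
      · rw [hj', h0]
      · rw [lim_eq_zero I (by omega)] at hj
        exact Nat.le_zero.1 hj

/-- Induction along the computation, for all `V` that leave exactly `x` to be read and the letters
of `y` to be written. Since `y` makes up the missing counts, no limit is exceeded and every
transition is enabled; when nothing remains, `V` is final. -/
theorem marked_of_computation (hR : ∀ V ≤ I.lim, V (I.numOut + 1) = 0 → I.Closed R V)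
    {s s' : Fin I.numStates} {x y} (h : I.machine.Computation s x y s') :
    ∀ V ≤ I.lim, V (I.numOut + 1) = 0 → I.x.drop (V 0) = x →
      (∀ b : Fin I.numOut, V (b + 1) + y.count b = I.c b) →
      R (I.numStates * I.val V + s) ≠ 0 → R (I.numStates * I.val I.finalDigits + s') ≠ 0 := by
  induction h with
  | nil s =>
    intro V hV h0 hx hc hs
    rwa [← eq_finalDigits hV h0 (List.drop_eq_nil_iff.1 hx) (by simpa using hc)]
  | @cons s s' s'' a b x y ht _ ih =>
    intro V hV h0 hx hc hs
    have hτ : (s, a, s', b) ∈ I.trans := ht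
    have he : I.Enabled V (s, a, s', b) := by
      constructor
      · cases a with
        | none => exact .inl rfl
        | some a =>
          right
          rw [inputCode_eq_letterCode (by simp [letterCode])]
          exact (RAM.lt_length_of_drop_eq_cons hx).2.1
      · cases b with
        | none => exact .inl rfl
        | some b =>
          right
          have := hc b
          simp only [Option.toList_some, List.count_append, List.count_singleton_self] at this
          simp only [letterCode, Option.elim_some, lim, dif_pos b.2, Fin.eta]
          omega
    refine ih (move V (s, a, s', b)) (move_le_lim hV he) (by rw [move_overflow, h0]) ?_ ?_ ?_
    · cases a with
      | none => cases b <;> simpa [move, letterCode] using hx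
      | some a =>
        have := (RAM.lt_length_of_drop_eq_cons hx).2.2
        cases b <;> simpa [move, letterCode] using this
    · intro b'
      rw [← hc b']
      cases b with
      | none => simp [move, letterCode]
      | some b =>
        simp only [move, letterCode, Option.elim_some, List.count_append, Option.toList_some,
          List.count_singleton]
        by_cases hb : b = b'
        · subst hb
          simp
          omega
        · have : (b' : ℕ) ≠ b := fun h => hb (Fin.ext h.symm)
          simp [hb, this]
    · rw [val_move]
      exact hR V hV h0 _ hτ he hs

theorem Progress.yes_iff (h : I.Progress V R) (hval : I.val V = I.wt (I.numOut + 1)) :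
    (∃ s < I.numStates, R (I.numStates * I.val I.finalDigits + s) ≠ 0) ↔ I.Yes := by
  constructor
  · rintro ⟨s, hs, hm⟩
    obtain ⟨y, hy, hc⟩ := h.sound.reach (s := ⟨s, hs⟩) finalDigits_le hm
    refine ⟨y, ⟨_, by simpa [finalDigits, lim, machine] using hy⟩, fun b => ?_⟩
    rw [hc, finalDigits, if_pos (by omega), lim, dif_pos b.2]
  · rintro ⟨y, ⟨s, hy⟩, hc⟩
    refine ⟨s, s.2, marked_of_computation (fun W hW h0 => h.closed W hW ?_) hy 0
      (fun j => Nat.zero_le _) rfl rfl (fun b => ?_) ?_⟩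
    -- The search has reached the overflow value, so every layer without overflow has been treated.
    · rw [hval]
      exact (val_lt_iff hW).2 h0
    · simpa using hc b
    · simpa [val_zero, machine] using h.start

end GWMMInstance

namespace RAM

open GWMMInstance

theorem Loaded.of_frame {I : GWMMInstance} {p : Prog} {s s' : State} (h : Loaded I s)
    (hf : Frame p s s') (h7 : p.writesReg 7 = false := by rfl)
    (h8 : p.writesReg 8 = false := by rfl) (h9 : p.writesReg 9 = false := by rfl)
    (h10 : p.writesReg 10 = false := by rfl) (a1 : p.writesArr 1 = false := by rfl)
    (a2 : p.writesArr 2 = false := by rfl) (a3 : p.writesArr 3 = false := by rfl)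
    (a6 : p.writesArr 6 = false := by rfl) (a7 : p.writesArr 7 = false := by rfl)
    (a8 : p.writesArr 8 = false := by rfl) (a9 : p.writesArr 9 = false := by rfl) :
    Loaded I s' := by
  refine ⟨(hf.reg 7 h7).trans h.one, (hf.reg 8 h8).trans h.states, (hf.reg 9 h9).trans h.letters,
    (hf.reg 10 h10).trans h.transitions, (hf.arr 1 a1).trans h.word, fun j hj => ?_, ?_,
    fun t τ ht hτ => ?_⟩
  · rw [hf.arr 2 a2, hf.arr 3 a3]
    exact h.strides j hj
  · rw [hf.arr 2 a2]
    exact h.overflow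
  · rw [hf.arr 6 a6, hf.arr 7 a7, hf.arr 8 a8, hf.arr 9 a9]
    exact h.trans t τ ht hτ

theorem Loaded.limits {I : GWMMInstance} {s : State} (h : Loaded I s) {j : ℕ}
    (hj : j ≤ I.numOut + 1) : s.arr 2 j = I.lim j := by
  rcases Nat.le_succ_iff.1 hj with hj | rfl
  · exact (h.strides j hj).1
  · rw [lim_overflow]
    exact h.overflow

/-! ## The search -/

/-- Marks along the transition with the number in register `11`. -/
def searchStep : Prog :=
  .seq (block [.load 2 6 11, .add 2 2 13, .load 2 5 2, .load 3 7 11, .load 4 8 11, .add 4 4 13,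
    .load 6 9 11])
  (.seq (.ite 3
    (.seq (block [.sub 16 3 22, .sub 17 22 3, .add 16 16 17])
      (.ite 16 (block [.const 2 0]) (block [.add 4 4 8])))
    (block []))
  (.seq (.ite 6
    (.seq (block [.load 16 2 6, .load 17 4 6, .sub 16 16 17])
      (.ite 16 (block [.load 17 3 6, .add 4 4 17]) (block [.const 2 0])))
    (block []))
  (.ite 2 (block [.store 5 4 7]) (block []))))

/-- The layer with the digits `V` is treated. -/
structure InLayer (I : GWMMInstance) (V : ℕ → ℕ) (s : State) : Prop where
  loaded : Loaded I s
  base : s.reg 13 = I.numStates * I.val V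
  digits : s.arr 4 = V
  letter : s.reg 22 = I.inputCode (V 0)

theorem InLayer.of_frame {I : GWMMInstance} {V : ℕ → ℕ} {p : Prog} {s s' : State}
    (h : InLayer I V s) (hf : Frame p s s') (hl : Loaded I s')
    (h13 : p.writesReg 13 = false := by rfl) (h22 : p.writesReg 22 = false := by rfl)
    (a4 : p.writesArr 4 = false := by rfl) : InLayer I V s' :=
  ⟨hl, (hf.reg 13 h13).trans h.base, (hf.arr 4 a4).trans h.digits, (hf.reg 22 h22).trans h.letter⟩

theorem searchStep_runs {I : GWMMInstance} {V : ℕ → ℕ} {s : State} (h : InLayer I V s)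
    {τ : Fin I.numStates × Option (Fin I.numIn) × Fin I.numStates × Option (Fin I.numOut)}
    (hτ : I.trans[s.reg 11]? = some τ) :
    Runs searchStep s 40 (fun s' => s'.arr 5 = I.markStep V (s.arr 5) τ) := by
  have hlt : s.reg 11 < I.trans.length := (List.getElem?_eq_some_iff.1 hτ).1
  obtain ⟨t6, t7, t8, t9⟩ := h.loaded.trans _ _ hlt hτ
  refine Runs.block_seq (fun t => t.reg 2 = s.arr 5 (I.numStates * I.val V + τ.1) ∧
    t.reg 3 = letterCode τ.2.1 ∧ t.reg 4 = I.numStates * I.val V + τ.2.2.1 ∧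
    t.reg 6 = letterCode τ.2.2.2) (by simp)
    (by simp [applyAll, Instr.apply, t6, t7, t8, t9, h.base, add_comm]) ?_
  rintro s₁ hf₁ ⟨a2, a3, a4, a6⟩
  have h₁ := h.of_frame hf₁ (h.loaded.of_frame hf₁)
  -- Register `2` carries the mark of the source and is cleared if the transition is blocked;
  -- register `4` accumulates the index of the target.
  refine Runs.seq (T₁ := 10) (P := fun t =>
    ((letterCode τ.2.1 = 0 ∨ I.inputCode (V 0) = letterCode τ.2.1) → t.reg 2 = s₁.reg 2 ∧
      t.reg 4 = s₁.reg 4 + if letterCode τ.2.1 = 0 then 0 else I.numStates) ∧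
    (¬ (letterCode τ.2.1 = 0 ∨ I.inputCode (V 0) = letterCode τ.2.1) → t.reg 2 = 0))
    ?_ (by simp) ?_
  · refine Runs.ite (by simp) (fun h3 => ?_) (fun h3 => ?_)
    · rw [a3] at h3
      -- The sum of the two truncated differences vanishes exactly if the two codes are equal.
      refine Runs.block_seq (fun t => t.reg 2 = s₁.reg 2 ∧ t.reg 4 = s₁.reg 4 ∧
        t.reg 8 = I.numStates ∧
        t.reg 16 = (letterCode τ.2.1 - I.inputCode (V 0)) + (I.inputCode (V 0) - letterCode τ.2.1))
        (by simp) (by simp [applyAll, Instr.apply, a3, h₁.letter, h₁.loaded.states]) ?_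
      rintro t hft ⟨b2, b4, b8, b16⟩
      refine Runs.ite (by simp) (fun h => ?_) (fun h => ?_)
      · rw [b16] at h
        have hne : ¬ (letterCode τ.2.1 = 0 ∨ I.inputCode (V 0) = letterCode τ.2.1) := by omega
        exact Runs.block (by simp) ⟨fun h => absurd h hne, fun _ => by simp [applyAll, Instr.apply]⟩
      · rw [b16] at h
        have hne : (letterCode τ.2.1 = 0 ∨ I.inputCode (V 0) = letterCode τ.2.1) := by omega
        exact Runs.block (by simp) ⟨fun _ => by simp [applyAll, Instr.apply, b2, b4, b8, h3],
          fun h => absurd hne h⟩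
    · rw [a3] at h3
      exact Runs.block (by simp) ⟨fun _ => by simp [applyAll, h3], fun h => absurd (.inl h3) h⟩
  rintro s₂ hf₂ ⟨c, c'⟩
  have h₂ := h₁.of_frame hf₂ (h₁.loaded.of_frame hf₂)
  have c6 : s₂.reg 6 = letterCode τ.2.2.2 := (hf₂.reg 6 rfl).trans a6
  refine Runs.seq (T₁ := 10) (P := fun t =>
    ((letterCode τ.2.2.2 = 0 ∨ V (letterCode τ.2.2.2) < I.lim (letterCode τ.2.2.2)) →
      t.reg 2 = s₂.reg 2 ∧ t.reg 4 = s₂.reg 4 +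
        if letterCode τ.2.2.2 = 0 then 0 else I.numStates * I.wt (letterCode τ.2.2.2)) ∧
    (¬ (letterCode τ.2.2.2 = 0 ∨ V (letterCode τ.2.2.2) < I.lim (letterCode τ.2.2.2)) →
      t.reg 2 = 0))
    ?_ (by simp) ?_
  · refine Runs.ite (by simp) (fun h6 => ?_) (fun h6 => ?_)
    · rw [c6] at h6
      obtain ⟨l2, l3⟩ := h₂.loaded.strides _ (letterCode_le τ.2.2.2)
      refine Runs.block_seq (fun t => t.reg 2 = s₂.reg 2 ∧ t.reg 4 = s₂.reg 4 ∧
        t.arr 3 (t.reg 6) = I.numStates * I.wt (letterCode τ.2.2.2) ∧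
        t.reg 16 = I.lim (letterCode τ.2.2.2) - V (letterCode τ.2.2.2))
        (by simp) (by simp [applyAll, Instr.apply, c6, h₂.digits, l2, l3]) ?_
      rintro t hft ⟨b2, b4, b3, b16⟩
      refine Runs.ite (by simp) (fun h => ?_) (fun h => ?_)
      · rw [b16] at h
        have hne : letterCode τ.2.2.2 = 0 ∨
          V (letterCode τ.2.2.2) < I.lim (letterCode τ.2.2.2) := by omega
        exact Runs.block (by simp) ⟨fun _ => by simp [applyAll, Instr.apply, b2, b4, b3, h6],
          fun h => absurd hne h⟩
      · rw [b16] at h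
        have hne : ¬ (letterCode τ.2.2.2 = 0 ∨
          V (letterCode τ.2.2.2) < I.lim (letterCode τ.2.2.2)) := by omega
        exact Runs.block (by simp) ⟨fun h => absurd h hne, fun _ => by simp [applyAll, Instr.apply]⟩
    · rw [c6] at h6
      exact Runs.block (by simp) ⟨fun _ => by simp [applyAll, h6], fun h => absurd (.inl h6) h⟩
  rintro s₃ hf₃ ⟨d, d'⟩
  have k5 : s₃.arr 5 = s.arr 5 := by rw [hf₃.arr 5 rfl, hf₂.arr 5 rfl, hf₁.arr 5 rfl]
  have k7 : s₃.reg 7 = 1 := (hf₃.reg 7 rfl).trans h₂.loaded.one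
  refine Runs.ite (by simp) (fun h2 => Runs.block (by simp) ?_)
    (fun h2 => Runs.block (by simp) ?_)
  · have hb : letterCode τ.2.2.2 = 0 ∨ V (letterCode τ.2.2.2) < I.lim (letterCode τ.2.2.2) :=
      by_contra fun hn => h2 (d' hn)
    obtain ⟨d2, d4⟩ := d hb
    have ha : letterCode τ.2.1 = 0 ∨ I.inputCode (V 0) = letterCode τ.2.1 :=
      by_contra fun hn => h2 (d2.trans (c' hn))
    obtain ⟨c2, c4⟩ := c ha
    rw [d2, c2, a2] at h2
    have hidx : s₃.reg 4 = I.numStates * (I.val V + I.shift τ) + τ.2.2.1 := by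
      rw [d4, c4, a4, shift]
      split_ifs <;> ring
    rw [markStep, if_pos ⟨h2, ha, hb⟩, ← hidx]
    simp [applyAll, Instr.apply, k5, k7]
  · rw [markStep, if_neg]
    · exact k5
    · rintro ⟨hm, ha, hb⟩
      rw [(d hb).1, (c ha).1, a2] at h2
      exact hm h2

/-- Marks along all transitions. -/
def searchPass : Prog :=
  .seq (block [.const 11 0, .sub 5 10 11])
  (.loop 5 (.seq searchStep (block [.add 11 11 7, .sub 5 10 11])))

theorem searchPass_runs {I : GWMMInstance} {V : ℕ → ℕ} {s : State} (h : InLayer I V s) :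
    Runs searchPass s (I.trans.length * 50 + 10)
      (fun s' => s'.arr 5 = I.markPass V (s.arr 5)) := by
  refine Runs.block_seq (fun t => t.reg 11 = 0 ∧ t.reg 5 = I.trans.length) (by simp)
    (by simp [applyAll, Instr.apply, h.loaded.transitions]) ?_
  rintro s₁ hf₁ ⟨a11, a5⟩
  have h₁ := h.of_frame hf₁ (h.loaded.of_frame hf₁)
  refine (Runs.loop_list (fun l t => I.trans.drop (t.reg 11) = l ∧
    t.reg 5 = I.trans.length - t.reg 11 ∧
    l.foldl (I.markStep V) (t.arr 5) = I.markPass V (s.arr 5)) (fun _ => 45) I.trans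
    ?_ ?_ ?_).mono ?_ ?_
  · refine ⟨by rw [a11]; rfl, by rw [a11, a5]; rfl, ?_⟩
    rw [hf₁.arr 5 rfl]
    rfl
  · rintro τ l t hft ⟨b11, b5, bR⟩
    obtain ⟨hlt, hget, hdrop⟩ := lt_length_of_drop_eq_cons b11
    have ht := h₁.of_frame hft (h₁.loaded.of_frame hft)
    refine ⟨by omega, ?_⟩
    refine Runs.seq (searchStep_runs ht hget) (by simp) ?_
    intro u hfu hu
    have hl := ht.loaded.of_frame hfu
    have hu11 := hfu.reg 11 rfl
    refine Runs.block (by simp) ⟨?_, ?_, ?_⟩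
    · simpa [applyAll, Instr.apply, hl.one, hu11] using hdrop
    · simp [applyAll, Instr.apply, hl.one, hl.transitions]
    · rw [← bR, List.foldl_cons, ← hu]
      rfl
  · rintro t hft ⟨b11, b5, bR⟩
    have := List.drop_eq_nil_iff.1 b11
    omega
  · simp
    omega
  · rintro t hft ⟨b11, b5, bR⟩
    exact bR

/-- Treats a layer. -/
def searchLayer : Prog :=
  .seq (block [.const 12 0, .load 22 4 12, .load 22 1 22, .add 14 8 7])
  (.loop 14 (.seq searchPass (block [.sub 14 14 7])))

theorem searchLayer_runs {I : GWMMInstance} {V : ℕ → ℕ} {s : State} (h : Loaded I s)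
    (h13 : s.reg 13 = I.numStates * I.val V) (h4 : s.arr 4 = V) :
    Runs searchLayer s ((I.numStates + 1) * (I.trans.length * 50 + 20) + 10)
      (fun s' => s'.arr 5 = I.markLayer V (s.arr 5)) := by
  refine Runs.block_seq (fun t => t.reg 22 = I.inputCode (V 0) ∧ t.reg 14 = I.numStates + 1)
    (by simp) (by simp [applyAll, Instr.apply, h.word, h.states, h.one, h4]) ?_
  rintro s₁ hf₁ ⟨a22, a14⟩
  have h₁ : InLayer I V s₁ :=
    ⟨h.of_frame hf₁, (hf₁.reg 13 rfl).trans h13, (hf₁.arr 4 rfl).trans h4, a22⟩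
  refine (Runs.loop_count (fun n t => t.reg 14 = n ∧ n ≤ I.numStates + 1 ∧
    t.arr 5 = (I.markPass V)^[I.numStates + 1 - n] (s.arr 5)) (I.trans.length * 50 + 15)
    (I.numStates + 1) ?_ ?_ ?_).mono ?_ ?_
  · refine ⟨a14, le_rfl, ?_⟩
    rw [hf₁.arr 5 rfl, Nat.sub_self]
    rfl
  · rintro n t hft ⟨b14, hn, b5⟩
    have ht := h₁.of_frame hft (h₁.loaded.of_frame hft)
    refine ⟨by omega, Runs.seq (searchPass_runs ht) (by omega) ?_⟩
    intro u hfu hu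
    have hl := ht.loaded.of_frame hfu
    refine Runs.block (by simp) ⟨?_, by omega, ?_⟩
    · simp [applyAll, Instr.apply, hl.one, hfu.reg 14 rfl, b14]
    · rw [show I.numStates + 1 - n = I.numStates + 1 - (n + 1) + 1 by omega,
        Function.iterate_succ_apply', ← b5, ← hu]
      rfl
  · rintro t hft ⟨b14, -⟩
    exact b14
  · simp
    have : (I.numStates + 1) * (I.trans.length * 50 + 15 + 1) ≤
      (I.numStates + 1) * (I.trans.length * 50 + 20) := Nat.mul_le_mul_left _ (by omega)
    omega
  · rintro t hft ⟨-, -, b5⟩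
    exact b5

/-- Passes to the next layer. Register `15` is `0` after the last one. -/
def nextLayer : Prog :=
  .seq (block [.const 12 0, .load 3 2 12, .load 4 4 12, .sub 3 3 4, .sub 5 7 3])
  (.seq (.loop 5 (block [.const 2 0, .store 4 12 2, .add 12 12 7, .load 3 2 12, .load 4 4 12,
    .sub 3 3 4, .sub 5 7 3]))
  (block [.load 4 4 12, .add 4 4 7, .store 4 12 4, .add 12 9 7, .load 15 4 12, .sub 15 7 15,
    .add 13 13 8]))

/-- Increment with carry. The carry passes over the full digits and may end in the overflow digit,
so the limit of that digit is stored as well. -/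
theorem nextLayer_runs {I : GWMMInstance} {V : ℕ → ℕ} {s : State} (h : Loaded I s)
    (h4 : s.arr 4 = V) (hV : V ≤ I.lim) (h0 : V (I.numOut + 1) = 0) :
    Runs nextLayer s ((I.numOut + 1) * 10 + 20)
      (fun s' => s'.reg 13 = s.reg 13 + I.numStates ∧ s'.reg 15 = 1 - s'.arr 4 (I.numOut + 1) ∧
        s'.arr 4 ≤ I.lim ∧ I.val (s'.arr 4) = I.val V + 1) := by
  classical
  -- The overflow digit is `0` and has limit `1`, so the carry always stops.
  have hex : ∃ m, V m < I.lim m := ⟨I.numOut + 1, by rw [h0, lim_overflow]; exact one_pos⟩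
  obtain ⟨m, hm, hmin⟩ : ∃ m, V m < I.lim m ∧ ∀ j < m, ¬ V j < I.lim j :=
    ⟨Nat.find hex, Nat.find_spec hex, fun j hj => Nat.find_min hex hj⟩
  have hmin' : ∀ j < m, V j = I.lim j := fun j hj => le_antisymm (hV j) (not_lt.1 (hmin j hj))
  have hmle : m ≤ I.numOut + 1 := by
    by_contra hlt
    exact hmin (I.numOut + 1) (by omega) (by rw [h0, lim_overflow]; exact one_pos)
  refine Runs.block_seq (fun t => t.reg 12 = 0 ∧ t.reg 5 = 1 - (I.lim 0 - V 0)) (by simp)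
    (by simp [applyAll, Instr.apply, h.one, h4, h.limits (Nat.zero_le _)]) ?_
  rintro s₁ hf₁ ⟨a12, a5⟩
  have hl₁ := h.of_frame hf₁
  refine Runs.seq (Runs.loop_count (fun n t => t.reg 12 + n = m ∧
    t.arr 4 = (fun j => if j < t.reg 12 then 0 else V j) ∧
    t.reg 5 = 1 - (I.lim (t.reg 12) - V (t.reg 12))) 9 m ?_ ?_ ?_) (by simp; omega) ?_
  · refine ⟨by omega, ?_, by rw [a5, a12]⟩
    rw [hf₁.arr 4 rfl, h4, a12]
    simp
  · rintro n t hft ⟨b12, b4, b5⟩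
    have hl := hl₁.of_frame hft
    have := hmin' (t.reg 12) (by omega)
    refine ⟨by omega, Runs.block (by simp) ⟨?_, ?_, ?_⟩⟩
    · simp [applyAll, Instr.apply, hl.one]
      omega
    · funext j
      simp [applyAll, Instr.apply, hl.one, b4]
      rw [Function.update_apply]
      split_ifs <;> first | rfl | omega
    · simp [applyAll, Instr.apply, hl.one, b4,
        hl.limits (j := t.reg 12 + 1) (by omega)]
  · rintro t hft ⟨b12, b4, b5⟩
    rw [b5, show t.reg 12 = m by omega]
    omega
  · rintro t hft ⟨b12, b4, b5⟩
    have hl := hl₁.of_frame hft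
    have c12 : t.reg 12 = m := by omega
    refine Runs.mono (P := fun z => z.reg 13 = t.reg 13 + t.reg 8 ∧
        z.reg 15 = 1 - z.arr 4 (t.reg 9 + 1) ∧
        z.arr 4 = Function.update (t.arr 4) (t.reg 12) (t.arr 4 (t.reg 12) + 1))
        (Runs.block le_rfl (by simp [applyAll, Instr.apply, hl.one])) (by simp; omega) ?_
    rintro z hfz ⟨d13, d15, d4⟩
    have hz : z.arr 4 = incr m V := by
      rw [d4, b4, c12, incr]
      simp
    refine ⟨?_, ?_, ?_, ?_⟩
    · rw [d13, hft.reg 13 rfl, hf₁.reg 13 rfl, hl.states]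
    · rw [d15, hl.letters]
    · rw [hz]
      exact incr_le_lim hV hm
    · rw [hz]
      exact val_incr hmle hmin'

/-- Treats all layers. -/
def searchAll : Prog :=
  .seq (block [.const 13 0, .const 15 1]) (.loop 15 (.seq searchLayer nextLayer))

/-- Upper bound for the time that a layer takes. -/
def layerTime (I : GWMMInstance) : ℕ :=
  (I.numStates + 1) * (I.trans.length * 50 + 20) + (I.numOut + 1) * 10 + 30

theorem searchAll_runs {I : GWMMInstance} {s : State} (h : Loaded I s)
    (h4 : s.arr 4 = 0) (h5 : s.arr 5 = Function.update (0 : ℕ → ℕ) (I.start : ℕ) 1) :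
    Runs searchAll s (I.wt (I.numOut + 1) * (layerTime I + 1) + 4)
      (fun s' => s'.reg 13 = I.numStates * I.wt (I.numOut + 1) ∧
        ∃ V, I.Progress V (s'.arr 5) ∧ I.val V = I.wt (I.numOut + 1)) := by
  refine Runs.block_seq (fun t => t.reg 13 = 0 ∧ t.reg 15 = 1) (by simp)
    (by simp [applyAll, Instr.apply]) ?_
  rintro s₁ hf₁ ⟨a13, a15⟩
  have hl₁ := h.of_frame hf₁
  -- The value grows by one per round, so the number of remaining rounds is its distance from the
  -- overflow value.
  refine (Runs.loop_count (fun n t => I.val (t.arr 4) + n = I.wt (I.numOut + 1) ∧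
    I.Progress (t.arr 4) (t.arr 5) ∧ t.reg 13 = I.numStates * I.val (t.arr 4) ∧
    t.reg 15 = 1 - t.arr 4 (I.numOut + 1)) (layerTime I) (I.wt (I.numOut + 1)) ?_ ?_ ?_).mono ?_ ?_
  · rw [hf₁.arr 4 rfl, h4, hf₁.arr 5 rfl, h5]
    exact ⟨by rw [val_zero, zero_add], Progress.init, by rw [val_zero, a13, mul_zero],
      by rw [a15]; rfl⟩
  · rintro n t hft ⟨bn, bP, b13, b15⟩
    have hl := hl₁.of_frame hft
    have h0 : t.arr 4 (I.numOut + 1) = 0 := (val_lt_iff bP.le_lim).1 (by omega)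
    refine ⟨by omega, ?_⟩
    refine Runs.seq (searchLayer_runs hl b13 rfl) (by rw [layerTime]; omega) ?_
    intro u hfu hu
    refine (nextLayer_runs (hl.of_frame hfu) (hfu.arr 4 rfl) bP.le_lim h0).mono
      (by rw [layerTime]; omega) ?_
    rintro v hfv ⟨c13, c15, cle, cval⟩
    refine ⟨by omega, ?_, ?_, c15⟩
    · rw [hfv.arr 5 rfl, hu]
      exact bP.markLayer h0 cle cval
    · rw [c13, hfu.reg 13 rfl, b13, cval]
      ring
  · rintro t hft ⟨bn, bP, b13, b15⟩
    have := mt (val_lt_iff bP.le_lim).2 (by omega)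
    omega
  · simp
  · rintro t hft ⟨bn, bP, b13, b15⟩
    rw [add_zero] at bn
    exact ⟨by rw [b13, bn], t.arr 4, bP, bn⟩

/-- Looks for marks in the last layer. -/
def checkLast : Prog :=
  .seq (block [.sub 13 13 8, .copy 14 8])
  (.loop 14 (block [.load 2 5 13, .add 0 0 2, .add 13 13 7, .sub 14 14 7]))

theorem checkLast_runs {I : GWMMInstance} {s : State} (h : Loaded I s) (h0 : s.reg 0 = 0) :
    Runs checkLast s (I.numStates * 6 + 4)
      (fun s' => s'.reg 0 ≠ 0 ↔ ∃ i < I.numStates, s.arr 5 (s.reg 13 - I.numStates + i) ≠ 0) := by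
  refine Runs.block_seq (fun t => t.reg 13 = s.reg 13 - I.numStates ∧ t.reg 14 = I.numStates)
    (by simp) (by simp [applyAll, Instr.apply, h.states]) ?_
  rintro s₁ hf₁ ⟨a13, a14⟩
  have hl₁ := h.of_frame hf₁
  refine (Runs.loop_count (fun n t => t.reg 14 = n ∧ n ≤ I.numStates ∧
    t.reg 13 = s.reg 13 - I.numStates + (I.numStates - n) ∧
    (t.reg 0 ≠ 0 ↔ ∃ i < I.numStates - n, s.arr 5 (s.reg 13 - I.numStates + i) ≠ 0))
    5 I.numStates ?_ ?_ ?_).mono ?_ ?_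
  · refine ⟨a14, le_rfl, by rw [a13, Nat.sub_self]; rfl, ?_⟩
    rw [hf₁.reg 0 rfl, h0, Nat.sub_self]
    simp
  · rintro n t hft ⟨b14, hn, b13, b0⟩
    have hl := hl₁.of_frame hft
    have b5 : t.arr 5 = s.arr 5 := (hft.arr 5 rfl).trans (hf₁.arr 5 rfl)
    refine ⟨by omega, Runs.mono (P := fun z => z.reg 14 = t.reg 14 - 1 ∧
      z.reg 13 = t.reg 13 + 1 ∧ z.reg 0 = t.reg 0 + s.arr 5 (t.reg 13))
      (Runs.block le_rfl (by simp [applyAll, Instr.apply, hl.one, b5])) (by simp) ?_⟩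
    rintro z hfz ⟨c14, c13, c0⟩
    have hn' : I.numStates - n = I.numStates - (n + 1) + 1 := by
      clear b0
      omega
    refine ⟨by rw [c14, b14, Nat.add_sub_cancel], Nat.le_of_succ_le hn,
      by rw [c13, b13, hn', add_assoc], ?_⟩
    have hadd : ∀ a b : ℕ, a + b ≠ 0 ↔ a ≠ 0 ∨ b ≠ 0 := by
      clear b0
      omega
    rw [c0, b13, hadd, b0, hn']
    constructor
    · rintro (⟨i, hi, hi'⟩ | hi)
      · exact ⟨i, by omega, hi'⟩
      · exact ⟨_, Nat.lt_succ_self _, hi⟩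
    · rintro ⟨i, hi, hi'⟩
      rcases Nat.lt_succ_iff_lt_or_eq.1 hi with hi | rfl
      · exact .inl ⟨i, hi, hi'⟩
      · exact .inr hi'
  · rintro t hft ⟨b14, -⟩
    exact b14
  · simp
  · rintro t hft ⟨-, -, -, b0⟩
    exact b0

/-- The algorithm for var-GWMM. -/
def solver : Prog := .seq readInstance (.seq searchAll checkLast)

theorem solver_runs (I : GWMMInstance) :
    Runs solver (init I.encode)
      (60 * I.encode.length + (I.wt (I.numOut + 1) * (layerTime I + 1) + 4) +
        (I.numStates * 6 + 4))
      (fun s => s.reg 0 ≠ 0 ↔ I.Yes) := by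
  refine Runs.seq (readInstance_runs I) (by omega) ?_
  rintro s₁ hf₁ ⟨hl, h0, h4, h5⟩
  refine Runs.seq (searchAll_runs hl h4 h5) (by omega) ?_
  rintro s₂ hf₂ ⟨h13, V, hP, hV⟩
  refine (checkLast_runs (hl.of_frame hf₂) ((hf₂.reg 0 rfl).trans h0)).mono (by omega) ?_
  intro s₃ hf₃ h
  -- Register `13` ends one layer past the accepting one, so subtracting `|S|` gives the first index
  -- of the accepting layer.
  rw [h, ← hP.yes_iff hV, h13, ← val_finalDigits, mul_add, mul_one, Nat.add_sub_cancel]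

end RAM

/-! ### Estimates for the running time -/

namespace GWMMInstance

/-- The transitions are distinct elements of `S × Γ × S × Σ`, and each factor has at most `k`
elements. `ε` is counted only where its flag is set, as in the definition of `k`. -/
theorem length_trans_le (I : GWMMInstance) : I.trans.length ≤ I.machine.size ^ 4 := by
  classical
  have hcard : ∀ (m : ℕ) (e : Bool),
      (Finset.univ.filter fun o : Option (Fin m) => o = none → e = true).card ≤ m + e.toNat := by
    intro m e
    cases e with
    | true => simp
    | false =>
      have : (Finset.univ.filter fun o : Option (Fin m) => o = none → false = true) =
          Finset.univ.map Function.Embedding.some := by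
        ext o
        cases o <;> simp
      rw [this]
      simp
  have hsub : I.trans.toFinset ⊆ Finset.univ ×ˢ
      ((Finset.univ.filter fun o : Option (Fin I.numIn) => o = none → I.epsIn = true) ×ˢ
      (Finset.univ ×ˢ
      (Finset.univ.filter fun o : Option (Fin I.numOut) => o = none → I.epsOut = true))) := by
    intro τ hτ
    rw [List.mem_toFinset] at hτ
    simpa using ⟨I.trans_in τ hτ, I.trans_out τ hτ⟩
  have hle := Finset.card_le_card hsub
  rw [List.toFinset_card_of_nodup I.trans_nodup] at hle
  simp only [Finset.card_product, Finset.card_univ, Fintype.card_fin] at hle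
  have h₁ : I.machine.size = I.numStates + (I.numIn + I.epsIn.toNat) +
      (I.numOut + I.epsOut.toNat) := by
    simp [MealyMachine.size, machine]
  refine hle.trans ?_
  rw [show I.machine.size ^ 4 = I.machine.size * (I.machine.size * (I.machine.size *
    I.machine.size)) by ring]
  refine Nat.mul_le_mul (by omega) (Nat.mul_le_mul ((hcard _ _).trans (by omega))
    (Nat.mul_le_mul (by omega) ((hcard _ _).trans (by omega))))

/-- Each of the `σ + 1` factors `|x| + 1` and `c b + 1` is at most `n`: every letter of `x` takes at
least one symbol, and `c b` in unary takes `c b + 1`. -/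
theorem wt_le (I : GWMMInstance) : I.wt (I.numOut + 1) ≤ I.encode.length ^ (I.numOut + 1) := by
  have hlen := congrArg List.length (RAM.encode_eq I)
  simp only [List.length_append] at hlen
  have hx : ∀ l : List ℕ, l.length ≤ (l.flatMap encBin).length := by
    intro l
    induction l with
    | nil => simp
    | cons a l ih =>
      have := RAM.encBin_length_pos a
      rw [List.flatMap_cons, List.length_append, List.length_cons]
      omega
  have hc : ∀ (l : List ℕ), ∀ v ∈ l, v + 1 ≤ (l.flatMap encUnary).length := by
    intro l v hv
    induction l with
    | nil => cases hv
    | cons a l ih =>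
      rw [List.flatMap_cons, List.length_append]
      rcases List.mem_cons.1 hv with rfl | hv
      · simp only [encUnary, List.length_append, List.length_replicate, List.length_singleton]
        omega
      · exact (ih hv).trans (Nat.le_add_left _ _)
  have key : ∀ j ∈ Finset.range (I.numOut + 1), I.lim j + 1 ≤ I.encode.length := by
    intro j hj
    cases j with
    | zero =>
      have h₁ := hx (I.x.map Fin.val)
      have h₂ := RAM.encBin_length_pos I.numStates
      rw [List.length_map] at h₁
      rw [lim]
      omega
    | succ j =>
      have hj : j < I.numOut := by simpa using hj
      have := hc (List.ofFn I.c) (I.c ⟨j, hj⟩) (by simp [List.mem_ofFn])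
      rw [lim, dif_pos hj]
      omega
  simpa [wt] using Finset.prod_le_prod' key

theorem size_pos (I : GWMMInstance) : 0 < I.machine.size ∧ I.numStates ≤ I.machine.size ∧
    I.numOut ≤ I.machine.size := by
  have := I.start.pos
  simp only [MealyMachine.size, Fintype.card_fin]
  omega

theorem encode_length_pos (I : GWMMInstance) : 0 < I.encode.length := by
  rw [RAM.encode_eq, List.length_append]
  have := RAM.encBin_length_pos I.numStates
  omega

theorem layerTime_le (I : GWMMInstance) : RAM.layerTime I + 1 ≤ 200 * I.machine.size ^ 5 := by
  obtain ⟨h0, hS, hσ⟩ := I.size_pos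
  have hT := I.length_trans_le
  have h4 : 1 ≤ I.machine.size ^ 4 := Nat.one_le_pow _ _ h0
  have h5 : I.machine.size ≤ I.machine.size ^ 5 := Nat.le_self_pow (by norm_num) _
  have h := Nat.mul_le_mul (show I.numStates + 1 ≤ 2 * I.machine.size by omega)
    (show I.trans.length * 50 + 20 ≤ 70 * I.machine.size ^ 4 by omega)
  have h' : 2 * I.machine.size * (70 * I.machine.size ^ 4) = 140 * I.machine.size ^ 5 := by ring
  rw [RAM.layerTime]
  omega

theorem solver_decidesWithin (I : GWMMInstance) :
    RAM.solver.DecidesWithin I.encode I.Yes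
      (300 * (I.encode.length ^ (I.numOut + 1) * I.machine.size ^ 5)) := by
  obtain ⟨t, s, he, ht, hs⟩ := RAM.solver_runs I
  refine ⟨t, s, he, ht.trans ?_, hs⟩
  obtain ⟨h0, hS, hσ⟩ := I.size_pos
  have hn := I.encode_length_pos
  have h5 : I.machine.size ≤ I.machine.size ^ 5 := Nat.le_self_pow (by norm_num) _
  have hp : I.encode.length ≤ I.encode.length ^ (I.numOut + 1) := Nat.le_self_pow (by omega) _
  -- The search contributes `200`, reading the input `60`, the final check `6` and the additive
  -- constants `8`, in total less than `300`.
  have k₁ := Nat.mul_le_mul I.wt_le I.layerTime_le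
  have k₂ := Nat.mul_le_mul hp (Nat.succ_le_of_lt (h0.trans_le h5))
  have k₃ := Nat.mul_le_mul (Nat.succ_le_of_lt (hn.trans_le hp)) (hS.trans h5)
  have k₄ : I.encode.length ^ (I.numOut + 1) * (200 * I.machine.size ^ 5) =
    200 * (I.encode.length ^ (I.numOut + 1) * I.machine.size ^ 5) := by ring
  simp only [Nat.succ_eq_add_one, zero_add, mul_one, one_mul] at k₂ k₃
  omega

end GWMMInstance

theorem mainTheorem8 :
    varGWMMUnary.InXP ∧
    ∃ (p : RAM.Prog) (C : ℕ), ∀ I : GWMMInstance,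
      p.DecidesWithin I.encode I.Yes
        (C * (I.encode.length ^ (I.numOut + 1) * I.machine.size ^ 5)) := by
  refine ⟨⟨fun k => 300 * k ^ 5, fun k => k + 1, ?_, ?_, RAM.solver, fun I => ?_⟩,
    RAM.solver, 300, GWMMInstance.solver_decidesWithin⟩
  · have h : Primrec fun k : ℕ => 300 * (k * k * k * k * k) :=
      Primrec.nat_mul.comp (.const 300) <| Primrec.nat_mul.comp (Primrec.nat_mul.comp
        (Primrec.nat_mul.comp (Primrec.nat_mul.comp .id .id) .id) .id) .id
    exact h.to_comp.of_eq fun k => by ring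
  · exact Computable.succ
  · obtain ⟨t, s, he, ht, hs⟩ := GWMMInstance.solver_decidesWithin I
    refine ⟨t, s, he, ht.trans ?_, hs⟩
    -- For membership in XP the exponent must depend on `k` alone; `σ ≤ k` allows `k + 1`.
    change _ ≤ 300 * I.machine.size ^ 5 * I.encode.length ^ (I.machine.size + 1)
    rw [mul_comm (I.encode.length ^ _), ← mul_assoc]
    exact Nat.mul_le_mul_left _ (Nat.pow_le_pow_right I.encode_length_pos
      (Nat.succ_le_succ I.size_pos.2.2))
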